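/- A \emph{long edge graph} $G$ is a graph with vertex set $\mathbb Z_{\ge 0}$ and a finite multiset of edges $e=(i\to j)$, $i<j$, with weights $w(e)\in\mathbb Z_{>0}$ (multiple edges are allowed), such that no edge $(i\to i+1)$ has weight $1$. Graphs with the same multiset of weighted edges are identified. Put $\ell(i\to j)=j-i$, $[n]_y=\frac{y^{n/2}-y^{-n/2}}{y^{1/2}-y^{-1/2}}$, $M(G)(y)=\prod_e([w(e)]_y)^2$ and $\delta(G)=\sum_e(\ell(e)w(e)-1)$ (the cogenus). Let $\mathrm{minv}(G)$ and $\mathrm{maxv}(G)$ be the smallest and the largest vertex incident to an edge (both $0$ if there are no edges), and $\ell(G)=\mathrm{maxv}(G)-\mathrm{minv}(G)$. Let $G_{(k)}$ be $G$ with all edges shifted to the right by $k$. Let $\epsilon_0(G)$ (resp. $\epsilon_1(G)$) be $1$ if all edges incident to $\mathrm{minv}(G)$ (resp. $\mathrm{maxv}(G)$) have weight $1$, and $0$ otherwise. A \emph{template} is a long edge graph $\Gamma$ with at least one edge and with $\mathrm{minv}(\Gamma)=0$ such that for every vertex $1\le i\le \ell(\Gamma)-1$ there is an edge $(j\to k)$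 with $j<i<k$. Let $\beta=(\beta_0,\ldots,\beta_M)\in\mathbb Z_{\ge 0}^{M+1}$, $M\ge 0$. For $j\geq 1$ let $\lambda_j(G)$ be the sum of the weights of the edges $(i\to k)$ of $G$ with $i<j\le k$. $G$ is \emph{$\beta$-allowable} if $\mathrm{maxv}(G)\le M+1$ and $\lambda_j(G)\le\beta_{j-1}$ for $j=1,\ldots,M+1$; it is \emph{strictly $\beta$-allowable} if moreover all edges incident to $0$ or $M+1$ have weight $1$. For $\beta$-allowable $G$, let $\mathrm{ext}_\beta(G)$ be obtained by adding $\beta_{j-1}-\lambda_j(G)$ edges $(j-1\to j)$ of weight $1$ for $j=1,\ldots,M+1$, and let $P_\beta(G)$ be the number of total orderings of the set of vertices and edges of $\mathrm{ext}_\beta(G)$ that extend the natural order of the vertices and in which each edge $(i\to j)$ lies between $i$ and $j$, counted up to permutations of the edges that permute only edges with the same endpoints and the same weight. Put $P_\beta(G)=0$ if $G$ is not $\beta$-allowable; let $P^s_\beta(G)=P_\beta(G)$ if $G$ is strictly $\beta$-allowable and $P^s_\beta(G)=0$ otherwise. Define $$N^\delta_\beta(y)=\sum_{\delta(G)=\delta}M(G)(y)\,P^s_\beta(G),\qquad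 \sum_{\delta>0}Q^\delta_\beta(y)t^\delta=\log\Big(1+\sum_{\delta>0}N^\delta_\beta(y)t^\delta\Big),$$ where the first sum is over all long edge graphs of cogenus $\delta$ (it has finitely many nonzero terms), and put $Q^0_\beta(y)=0$. Finally let $$\Phi_\beta(G)=\sum_{n\ge1}\frac{(-1)^{n+1}}n\sum_{(G_1,\ldots,G_n)}\prod_{j=1}^nP_\beta(G_j),$$ the inner sum being over the $n$-tuples of long edge graphs with nonempty edge sets whose multisets of weighted edges have disjoint union that of $G$. \textbf{Corollary.} For every $\beta\in\mathbb Z_{\ge 0}^{M+1}$ and every integer $\delta\ge 0$ there are only finitely many templates of cogenus $\delta$, and $$Q^\delta_\beta(y)=\sum_{\Gamma}M(\Gamma)(y)\sum_{k=1-\epsilon_0(\Gamma)}^{M-\ell(\Gamma)+\epsilon_1(\Gamma)}\Phi_\beta(\Gamma_{(k)}),$$ where the first sum is over all templates $\Gamma$ of cogenus $\delta$, and the inner sum is $0$ if its upper limit is smaller than its lower limit. -/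

import Mathlib

open scoped LaurentPolynomial

/-- A weighted edge `(src → tgt)`, `src < tgt`, between vertices in `ℕ`, of positive weight. -/
@[ext]
structure WEdge where
  src : ℕ
  tgt : ℕ
  wt : ℕ
  src_lt_tgt : src < tgt
  wt_pos : 0 < wt

namespace WEdge

noncomputable instance : DecidableEq WEdge := Classical.decEq _

/-- The length of an edge. -/
def len (e : WEdge) : ℕ := e.tgt - e.src

/-- A short edge: weight `1`, connecting `i` and `i + 1`. -/
def IsShort (e : WEdge) : Prop := e.tgt = e.src + 1 ∧ e.wt = 1

/-- The vertex `i` is an endpoint of `e`. -/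
def Incident (e : WEdge) (i : ℕ) : Prop := e.src = i ∨ e.tgt = i

/-- Translation of an edge by `k` to the right. -/
def shift (k : ℕ) (e : WEdge) : WEdge where
  src := e.src + k
  tgt := e.tgt + k
  wt := e.wt
  src_lt_tgt := Nat.add_lt_add_right e.src_lt_tgt k
  wt_pos := e.wt_pos

/-- The short edge `(i → i + 1)` of weight `1`. -/
def short (i : ℕ) : WEdge := ⟨i, i + 1, 1, Nat.lt_succ_self i, Nat.one_pos⟩

end WEdge

/-- An edge that is allowed in a long edge graph. -/
abbrev LongEdge : Type := {e : WEdge // ¬ e.IsShort}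

/-- A long edge graph: vertex set `ℕ`, given by its finite multiset of weighted edges
(multiple edges allowed, no loops, no short edges). Addition is the disjoint union of the
weighted edge sets, `0` is the graph without edges. -/
abbrev LongEdgeGraph : Type := Multiset LongEdge

/-- The quantum number `[n]_y = y^((n-1)/2) + y^((n-3)/2) + ⋯ + y^(-(n-1)/2)`, in the ring of
Laurent polynomials in the variable `T = y^(1/2)`. -/
noncomputable def quantumNumber (n : ℕ) : ℚ[T;T⁻¹] :=
  ∑ i ∈ Finset.range n, LaurentPolynomial.T ((n : ℤ) - 1 - 2 * (i : ℤ))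

namespace LongEdgeGraph

/-- The refined multiplicity `M(G)(y) = ∏ₑ ([w(e)]_y)²`. -/
noncomputable def mult (G : LongEdgeGraph) : ℚ[T;T⁻¹] :=
  (G.map fun e => quantumNumber e.1.wt ^ 2).prod

/-- The cogenus `δ(G) = ∑ₑ (ℓ(e) w(e) - 1)` (every summand is positive). -/
def cogenus (G : LongEdgeGraph) : ℕ :=
  (G.map fun e => e.1.len * e.1.wt - 1).sum

/-- The smallest vertex incident to an edge (`0` for the graph without edges). -/
noncomputable def minv (G : LongEdgeGraph) : ℕ := sInf {i | ∃ e ∈ G, e.1.Incident i}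

/-- The largest vertex incident to an edge (`0` for the graph without edges). -/
noncomputable def maxv (G : LongEdgeGraph) : ℕ := sSup {i | ∃ e ∈ G, e.1.Incident i}

/-- The length of a graph. -/
noncomputable def length (G : LongEdgeGraph) : ℕ := G.maxv - G.minv

/-- The graph `G_(k)`: all edges of `G` shifted to the right by `k`. -/
def shift (k : ℕ) (G : LongEdgeGraph) : LongEdgeGraph :=
  G.map fun e => ⟨e.1.shift k, fun h => e.2 ⟨by
    have h1 : e.1.tgt + k = e.1.src + k + 1 := h.1
    omega, h.2⟩⟩

open scoped Classical in
/-- `λ_j(G)`: the total weight of the edges `(i → k)` with `i < j ≤ k`. -/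
noncomputable def lam (j : ℕ) (G : LongEdgeGraph) : ℕ :=
  ((G.filter fun e => e.1.src < j ∧ j ≤ e.1.tgt).map fun e => e.1.wt).sum

/-- `β`-allowable graphs, for `β = (β_0, …, β_M)`. -/
def Allowable {M : ℕ} (β : Fin (M + 1) → ℕ) (G : LongEdgeGraph) : Prop :=
  G.maxv ≤ M + 1 ∧ ∀ j : Fin (M + 1), G.lam (j + 1) ≤ β j

/-- Strictly `β`-allowable graphs. -/
def StrictlyAllowable {M : ℕ} (β : Fin (M + 1) → ℕ) (G : LongEdgeGraph) : Prop :=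
  G.Allowable β ∧ ∀ e ∈ G, e.1.Incident 0 ∨ e.1.Incident (M + 1) → e.1.wt = 1

/-- `ext_β(G)`: add `β_{j-1} - λ_j(G)` edges of weight `1` from `j - 1` to `j`, for
`j = 1, …, M + 1`. (Used only for `β`-allowable `G`.) -/
noncomputable def extGraph {M : ℕ} (β : Fin (M + 1) → ℕ) (G : LongEdgeGraph) : Multiset WEdge :=
  G.map Subtype.val +
    ∑ j : Fin (M + 1), Multiset.replicate (β j - G.lam (j + 1)) (WEdge.short j)

end LongEdgeGraph

/-- Total orderings of the vertices (`Sum.inl`) and edges (`Sum.inr`) of a graph on `ℕ` with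
edge multiset `H`, which extend the natural ordering of the vertices and in which every edge
lies between its endpoints. Equal edges of `H` are distinct elements of the type `H`. -/
structure IsExtendedOrdering (H : Multiset WEdge) (r : ℕ ⊕ H → ℕ ⊕ H → Prop) : Prop where
  strictTotal : IsStrictTotalOrder (ℕ ⊕ H) r
  vertices : ∀ i j : ℕ, i < j → r (Sum.inl i) (Sum.inl j)
  between : ∀ e : H, r (Sum.inl e.1.src) (Sum.inr e) ∧ r (Sum.inr e) (Sum.inl e.1.tgt)

/-- The type of extended orderings of a graph on `ℕ` with edge multiset `H`. -/
abbrev ExtendedOrdering (H : Multiset WEdge) : Type :=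
  {r : ℕ ⊕ H → ℕ ⊕ H → Prop // IsExtendedOrdering H r}

/-- A finite graph has finitely many extended orderings. -/
instance ExtendedOrdering.finite (H : Multiset WEdge) : Finite (ExtendedOrdering H) := by
  refine Finite.of_injective
    (β := (H → H → Prop) × ((e : H) → Fin e.1.tgt → Prop))
    (fun o => (fun e e' => o.1 (Sum.inr e) (Sum.inr e'),
      fun e i => o.1 (Sum.inl i) (Sum.inr e))) ?_
  rintro ⟨r, hr⟩ ⟨s, hs⟩ h
  simp only [Prod.mk.injEq] at h
  obtain ⟨h1, h2⟩ := h
  have _ := hr.strictTotal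
  have _ := hs.strictTotal
  have key : ∀ (t : ℕ ⊕ H → ℕ ⊕ H → Prop), IsExtendedOrdering H t →
      (∀ i j : ℕ, t (Sum.inl i) (Sum.inl j) ↔ i < j) ∧
      (∀ (i : ℕ) (e : H), t (Sum.inr e) (Sum.inl i) ↔ ¬ t (Sum.inl i) (Sum.inr e)) ∧
      (∀ (i : ℕ) (e : H), e.1.tgt ≤ i → ¬ t (Sum.inl i) (Sum.inr e)) := by
    intro t ht
    have _ := ht.strictTotal
    have hlt : ∀ (i : ℕ) (e : H), e.1.tgt ≤ i → t (Sum.inr e) (Sum.inl i) := by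
      intro i e hi
      rcases hi.eq_or_lt with rfl | hi
      · exact (ht.between e).2
      · exact _root_.trans (ht.between e).2 (ht.vertices _ _ hi)
    refine ⟨fun i j => ⟨fun hij => ?_, ht.vertices i j⟩, fun i e => ⟨fun ha hb => ?_, fun ha => ?_⟩,
      fun i e hi ha => ?_⟩
    · by_contra hji
      rcases (not_lt.1 hji).eq_or_lt with rfl | hji
      · exact irrefl _ hij
      · exact asymm hij (ht.vertices _ _ hji)
    · exact asymm ha hb
    · rcases trichotomous_of t (Sum.inl i) (Sum.inr e) with hb | hb | hb
      · exact absurd hb ha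
      · cases hb
      · exact hb
    · exact asymm ha (hlt i e hi)
  obtain ⟨r1, r2, r3⟩ := key r hr
  obtain ⟨s1, s2, s3⟩ := key s hs
  have hve : ∀ (i : ℕ) (e : H), r (Sum.inl i) (Sum.inr e) ↔ s (Sum.inl i) (Sum.inr e) := by
    intro i e
    by_cases hi : i < e.1.tgt
    · exact iff_of_eq (congrFun (congrFun h2 e) ⟨i, hi⟩)
    · exact iff_of_false (r3 i e (not_lt.1 hi)) (s3 i e (not_lt.1 hi))
  apply Subtype.ext
  funext x y
  apply propext
  rcases x with i | e <;> rcases y with j | e'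
  · exact (r1 i j).trans (s1 i j).symm
  · exact hve i e'
  · exact (r2 j e).trans ((not_congr (hve j e)).trans (s2 j e).symm)
  · exact iff_of_eq (congrFun (congrFun h1 e) e')

/-- Two extended orderings are equivalent if a permutation of the edges, which permutes only
edges with the same endpoints and the same weight, sends one to the other. -/
instance ExtendedOrdering.setoid (H : Multiset WEdge) : Setoid (ExtendedOrdering H) where
  r o o' := ∃ σ : Equiv.Perm H, (∀ e : H, (σ e).1 = e.1) ∧
    ∀ x y, o.1 x y ↔ o'.1 (Sum.map id σ x) (Sum.map id σ y)
  iseqv :=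
    { refl := fun o => ⟨1, fun _ => rfl, fun x y => by
        have h : ∀ z : ℕ ⊕ H, Sum.map id (1 : Equiv.Perm H) z = z := by
          rintro (z | z) <;> rfl
        rw [h, h]⟩
      symm := by
        rintro o o' ⟨σ, h1, h2⟩
        refine ⟨σ.symm, fun e => ?_, fun x y => ?_⟩
        · have := h1 (σ.symm e)
          rw [Equiv.apply_symm_apply] at this
          exact this.symm
        · have h : ∀ z : ℕ ⊕ H, Sum.map id σ (Sum.map id σ.symm z) = z := by
            rintro (z | z) <;> simp
          rw [h2, h, h]
      trans := by
        rintro o o' o'' ⟨σ, h1, h2⟩ ⟨τ, h3, h4⟩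
        refine ⟨τ * σ, fun e => ?_, fun x y => ?_⟩
        · rw [Equiv.Perm.mul_apply, h3, h1]
        · have h : ∀ z : ℕ ⊕ H, Sum.map id (τ * σ) z = Sum.map id τ (Sum.map id σ z) := by
            rintro (z | z) <;> rfl
          rw [h2, h4, h, h] }

namespace LongEdgeGraph

variable {M : ℕ} (β : Fin (M + 1) → ℕ)

open scoped Classical in
/-- `P_β(G)`: the number of `β`-extended orderings of `G` up to equivalence, and `0` if `G` is
not `β`-allowable. -/
noncomputable def P (G : LongEdgeGraph) : ℕ :=
  if G.Allowable β then Nat.card (Quotient (ExtendedOrdering.setoid (G.extGraph β))) else 0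

open scoped Classical in
/-- `P^s_β(G)`: equal to `P_β(G)` if `G` is strictly `β`-allowable, and `0` otherwise. -/
noncomputable def Ps (G : LongEdgeGraph) : ℕ :=
  if G.StrictlyAllowable β then G.P β else 0

/-- The coefficient `N^δ_β(y) = ∑_G M(G) P^s_β(G)`, over all long edge graphs `G` of cogenus
`δ`; only finitely many summands are nonzero, see `finite_support_N` below. -/
noncomputable def N (δ : ℕ) : ℚ[T;T⁻¹] :=
  ∑ᶠ G : {G : LongEdgeGraph // G.cogenus = δ}, (G.1.Ps β : ℚ[T;T⁻¹]) * G.1.mult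

/-- The generating function `𝒩(β, y, t) = 1 + ∑_{δ > 0} N^δ_β(y) t^δ`. -/
noncomputable def genN : PowerSeries ℚ[T;T⁻¹] :=
  PowerSeries.mk fun δ => if δ = 0 then 1 else N β δ

/-- `Q^δ_β(y)`: the coefficient of `t^δ` in `𝒬(β, y, t) = log 𝒩(β, y, t)`. -/
noncomputable def Q (δ : ℕ) : ℚ[T;T⁻¹] :=
  PowerSeries.coeff δ (PowerSeries.logOf (genN β))

open scoped Classical in
/-- The partitions of `G` into `n` parts: the tuples `(G_1, …, G_n)` of nonempty long edge graphs
whose disjoint union is `G`. -/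
noncomputable def partitions (n : ℕ) (G : LongEdgeGraph) : Finset (Fin n → LongEdgeGraph) :=
  (Fintype.piFinset fun _ : Fin n => Finset.Iic G).filter
    fun p => (∀ j, p j ≠ 0) ∧ ∑ j, p j = G

/-- `Φ_β(G) = ∑_{n ≥ 1} (-1)^(n+1)/n ∑_{(G_1, …, G_n)} ∏_j P_β(G_j)`, over the partitions of
`G`; a partition has at most as many parts as `G` has edges. -/
noncomputable def Phi (G : LongEdgeGraph) : ℚ :=
  ∑ n ∈ Finset.Icc 1 (Multiset.card G), (-1 : ℚ) ^ (n + 1) / n *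
    ∑ p ∈ partitions n G, ∏ j, ((p j).P β : ℚ)

end LongEdgeGraph

namespace LongEdgeGraph

/-- A template: a nonempty long edge graph with `minv Γ = 0` such that every vertex `i` with
`1 ≤ i ≤ ℓ(Γ) - 1` lies strictly between the endpoints of some edge. -/
def IsTemplate (Γ : LongEdgeGraph) : Prop :=
  Γ ≠ 0 ∧ Γ.minv = 0 ∧
    ∀ i : ℕ, 1 ≤ i → i < Γ.length → ∃ e ∈ Γ, e.1.src < i ∧ i < e.1.tgt

open scoped Classical in
/-- `ε_0(G) = 1` if all edges incident to `minv G` have weight `1`, and `0` otherwise. -/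
noncomputable def eps0 (G : LongEdgeGraph) : ℕ :=
  if ∀ e ∈ G, e.1.Incident G.minv → e.1.wt = 1 then 1 else 0

open scoped Classical in
/-- `ε_1(G) = 1` if all edges incident to `maxv G` have weight `1`, and `0` otherwise. -/
noncomputable def eps1 (G : LongEdgeGraph) : ℕ :=
  if ∀ e ∈ G, e.1.Incident G.maxv → e.1.wt = 1 then 1 else 0

end LongEdgeGraph

/-- Being a partition is expressed by the two defining conditions alone. -/
theorem LongEdgeGraph.mem_partitions {n : ℕ} {G : LongEdgeGraph} {p : Fin n → LongEdgeGraph} :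
    p ∈ partitions n G ↔ (∀ j, p j ≠ 0) ∧ ∑ j, p j = G := by
  simp only [partitions, Finset.mem_filter, Fintype.mem_piFinset, Finset.mem_Iic]
  refine ⟨fun h => h.2, fun h => ⟨fun j => ?_, h⟩⟩
  rw [← h.2]
  exact Finset.single_le_sum (f := p) (fun _ _ => Multiset.zero_le _) (Finset.mem_univ j)

theorem LongEdgeGraph.card_le_of_mem_partitions {n : ℕ} {G : LongEdgeGraph}
    {p : Fin n → LongEdgeGraph} (h : p ∈ partitions n G) : n ≤ Multiset.card G := by
  rw [mem_partitions] at h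
  rw [← h.2, Multiset.card_sum]
  calc n = ∑ _j : Fin n, 1 := by simp
    _ ≤ _ := Finset.sum_le_sum fun j _ => Multiset.card_pos.2 (h.1 j)

/-- `[n]_y (y^(1/2) - y^(-1/2)) = y^(n/2) - y^(-n/2)`. -/
theorem quantumNumber_mul (n : ℕ) :
    quantumNumber n * (LaurentPolynomial.T 1 - LaurentPolynomial.T (-1)) =
      LaurentPolynomial.T (n : ℤ) - LaurentPolynomial.T (-(n : ℤ)) := by
  have h := Finset.sum_range_sub'
    (fun i : ℕ => (LaurentPolynomial.T ((n : ℤ) - 2 * (i : ℤ)) : ℚ[T;T⁻¹])) n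
  rw [quantumNumber, Finset.sum_mul]
  convert h using 2
  · rw [mul_sub, ← LaurentPolynomial.T_add, ← LaurentPolynomial.T_add]
    push_cast
    congr 2 <;> ring
  · simp
  · congr 1; ring

namespace LongEdgeGraph

theorem one_le_term (e : LongEdge) : 1 ≤ e.1.len * e.1.wt - 1 := by
  obtain ⟨⟨s, t, w, hst, hw⟩, h⟩ := e
  simp only [WEdge.IsShort, WEdge.len] at h ⊢
  obtain ⟨l, rfl⟩ : ∃ l, t = s + 1 + l := ⟨t - (s + 1), by omega⟩
  obtain ⟨v, rfl⟩ : ∃ v, w = v + 1 := ⟨w - 1, by omega⟩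
  have : s + 1 + l - s = l + 1 := by omega
  rw [this]
  rcases Nat.eq_zero_or_pos l with rfl | hl
  · have : v ≠ 0 := by rintro rfl; simp at h
    simp; omega
  · nlinarith [Nat.sub_add_cancel (show 1 ≤ (l + 1) * (v + 1) by nlinarith)]

theorem tgt_le_maxv {G : LongEdgeGraph} {e : LongEdge} (he : e ∈ G) : e.1.tgt ≤ G.maxv := by
  refine le_csSup ?_ ⟨e, he, Or.inr rfl⟩
  refine ⟨(G.map fun e => e.1.tgt).sum, ?_⟩
  rintro i ⟨e', he', hi⟩
  have h1 : e'.1.tgt ≤ (G.map fun e => e.1.tgt).sum :=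
    Multiset.single_le_sum (fun _ _ => Nat.zero_le _) _ (Multiset.mem_map_of_mem _ he')
  have h2 := e'.1.src_lt_tgt
  rcases hi with hi | hi <;> omega

/-- There are finitely many long edge graphs of given cogenus on boundedly many vertices. -/
theorem finite_cogenus_maxv (δ B : ℕ) :
    {G : LongEdgeGraph | G.cogenus = δ ∧ G.maxv ≤ B}.Finite := by
  have hS : {e : LongEdge | e.1.tgt ≤ B ∧ e.1.wt ≤ δ + 1}.Finite := by
    refine Set.Finite.of_finite_image
      (f := fun e : LongEdge => (e.1.src, e.1.tgt, e.1.wt)) ?_ ?_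
    · refine ((Set.finite_Iic B).prod ((Set.finite_Iic B).prod (Set.finite_Iic (δ + 1)))).subset ?_
      rintro _ ⟨e, ⟨h1, h2⟩, rfl⟩
      exact ⟨(e.1.src_lt_tgt.le.trans h1 : _), h1, h2⟩
    · intro e _ e' _ h
      simp only [Prod.mk.injEq] at h
      exact Subtype.ext (WEdge.ext h.1 h.2.1 h.2.2)
  refine (Set.finite_Iic (δ • hS.toFinset.val)).subset ?_
  rintro G ⟨hG, hB⟩
  rw [Set.mem_Iic, Multiset.le_iff_count]
  intro e
  by_cases he : e ∈ G
  · have hterm : e.1.len * e.1.wt - 1 ≤ δ := by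
      rw [← hG]
      exact Multiset.single_le_sum (fun _ _ => Nat.zero_le _) _
        (Multiset.mem_map_of_mem (fun e : LongEdge => e.1.len * e.1.wt - 1) he)
    have hw : e.1.wt ≤ δ + 1 := by
      have : 1 ≤ e.1.len := Nat.sub_pos_of_lt e.1.src_lt_tgt
      have : e.1.wt ≤ e.1.len * e.1.wt := Nat.le_mul_of_pos_left _ this
      omega
    have hmem : e ∈ hS.toFinset.val := by
      simpa using ⟨(tgt_le_maxv he).trans hB, hw⟩
    have hcard : Multiset.card G ≤ δ := by
      rw [← hG, cogenus]
      have := Multiset.card_nsmul_le_sum (s := G.map fun e => e.1.len * e.1.wt - 1) (a := 1) (by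
        intro x hx
        obtain ⟨e, -, rfl⟩ := Multiset.mem_map.1 hx
        exact one_le_term e)
      simpa using this
    rw [Multiset.count_nsmul, Multiset.count_eq_one_of_mem hS.toFinset.nodup hmem, mul_one]
    exact (Multiset.count_le_card _ _).trans hcard
  · rw [Multiset.count_eq_zero_of_notMem he]
    exact Nat.zero_le _

theorem finite_support_N {M : ℕ} (β : Fin (M + 1) → ℕ) (δ : ℕ) :
    (Function.support fun G : {G : LongEdgeGraph // G.cogenus = δ} =>
      (G.1.Ps β : ℚ[T;T⁻¹]) * G.1.mult).Finite := by
  refine ((finite_cogenus_maxv δ (M + 1)).preimage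
    (Subtype.val_injective.injOn (s := Set.univ) |>.mono (Set.subset_univ _))).subset ?_
  rintro ⟨G, hG⟩ h
  refine ⟨hG, ?_⟩
  by_contra hM
  refine h ?_
  have : G.Ps β = 0 := if_neg fun hs => hM hs.1.1
  simp [this]

end LongEdgeGraph

/-!
Disjoint union of graphs corresponds to multiplication in a power series ring with one variable for
each possible edge. In this ring, `Φ_β` is by definition the logarithm of `P_β`. The multiplicity is
multiplicative and the cogenus additive, so substituting `M(e) t^(δ(e))` for the variable of `e`
turns this into `Q^δ_β = ∑ M(G) Φ_β(G)`, the sum being over the graphs of cogenus `δ` that satisfy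
the strictness conditions (`Q_eq_logCoeff`); these conditions concern single edges, so they pass
between a graph and its parts. Logarithms are handled by logarithmic derivatives throughout:
`w P = P * (w Φ)` for every additive weight `w` on graphs (`weight_mul_P`), which with the cogenus
as weight determines `Q`.

It remains to see that `Φ_β(G) = 0` unless `G` is a shifted template. Any other nonempty `G` can be
cut at a vertex `m` into nonempty pieces `G₁`, to the left of `m`, and `G₂`, to the right. Extended
orderings are built independently on both sides of `m`, hence `P_β(G₁ + G₂) = P_β(G₁) P_β(G₂)`
(`P_add`), and the logarithm of a product has no mixed terms (`Phi_add_eq_zero`). To prove `P_add`,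
the equivalence classes of extended orderings are identified with words recording the edges in their
order, each with the gap between consecutive vertices that contains it
(`card_quotient_eq_ncard_gapWords`); such words can be cut at `m`. Finally, the strictness conditions
for `Γ_(k)` say exactly that `1 - ε₀(Γ) ≤ k ≤ M - ℓ(Γ) + ε₁(Γ)`.
-/

/-! ### Extended orderings as words -/

theorem IsExtendedOrdering.vertex_lt_iff {H : Multiset WEdge} {r : ℕ ⊕ H → ℕ ⊕ H → Prop}
    (h : IsExtendedOrdering H r) {i j : ℕ} : r (Sum.inl i) (Sum.inl j) ↔ i < j := by
  have _ := h.strictTotal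
  refine ⟨fun hij => ?_, h.vertices i j⟩
  by_contra hji
  rcases (not_lt.1 hji).eq_or_lt with rfl | hji
  · exact irrefl _ hij
  · exact asymm hij (h.vertices _ _ hji)

theorem IsExtendedOrdering.edge_vertex_iff {H : Multiset WEdge} {r : ℕ ⊕ H → ℕ ⊕ H → Prop}
    (h : IsExtendedOrdering H r) {i : ℕ} {e : H} :
    r (Sum.inr e) (Sum.inl i) ↔ ¬ r (Sum.inl i) (Sum.inr e) := by
  have _ := h.strictTotal
  refine ⟨fun ha hb => asymm ha hb, fun ha => ?_⟩
  rcases trichotomous_of r (Sum.inl i) (Sum.inr e) with hb | hb | hb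
  · exact absurd hb ha
  · cases hb
  · exact hb

/-- An extended ordering is determined by the vertices below each edge and by its restriction to
the edges. -/
theorem IsExtendedOrdering.ext {H : Multiset WEdge} {r s : ℕ ⊕ H → ℕ ⊕ H → Prop}
    (hr : IsExtendedOrdering H r) (hs : IsExtendedOrdering H s)
    (h1 : ∀ i e, r (Sum.inl i) (Sum.inr e) ↔ s (Sum.inl i) (Sum.inr e))
    (h2 : ∀ e e', r (Sum.inr e) (Sum.inr e') ↔ s (Sum.inr e) (Sum.inr e')) : r = s := by
  funext x y
  apply propext
  rcases x with i | e <;> rcases y with j | e'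
  · rw [hr.vertex_lt_iff, hs.vertex_lt_iff]
  · exact h1 i e'
  · rw [hr.edge_vertex_iff, hs.edge_vertex_iff, h1]
  · exact h2 e e'

theorem exists_equiv_of_map_univ_eq {α β γ : Type*} [Fintype α] [Fintype β] (u : α → γ)
    (v : β → γ) (h : Finset.univ.val.map u = Finset.univ.val.map v) :
    ∃ f : α ≃ β, ∀ a, v (f a) = u a := by
  classical
  have hc : ∀ c, Nonempty ({a // u a = c} ≃ {b // v b = c}) := by
    intro c
    have := congrArg (Multiset.count c) h
    rw [Multiset.count_map, Multiset.count_map] at this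
    rw [← Fintype.card_eq, Fintype.card_subtype, Fintype.card_subtype]
    simpa only [Finset.card_def, Finset.filter_val, eq_comm] using this
  exact ⟨Equiv.ofFiberEquiv fun c => (hc c).some, Equiv.ofFiberEquiv_map _⟩

/-- A placement of the edges of a finite graph on `ℕ`: an enumeration of the edges together with,
for each position, the index `i` of the gap between the vertices `i` and `i + 1` in which the edge
at this position is put. It describes an extended ordering. -/
structure Placement (H : Multiset WEdge) where
  edge : Fin (Multiset.card H) ≃ H
  gap : Fin (Multiset.card H) → ℕ
  mono : Monotone gap
  src_le : ∀ k, (edge k).1.src ≤ gap k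
  lt_tgt : ∀ k, gap k < (edge k).1.tgt

namespace Placement

variable {H : Multiset WEdge}

/-- The position of a vertex or an edge: vertex `i` comes first in gap `i`, and the edges
in a common gap follow in the order of the enumeration. -/
def position (p : Placement H) : ℕ ⊕ H → ℕ ×ₗ ℕ :=
  Sum.elim (fun i => toLex (i, 0)) fun e => toLex (p.gap (p.edge.symm e), p.edge.symm e + 1)

theorem position_injective (p : Placement H) : Function.Injective p.position := by
  rintro (i | e) (j | e') h
  · simpa [position] using h
  · simp [position] at h
  · simp [position] at h
  · simp only [position, Sum.elim_inr, EmbeddingLike.apply_eq_iff_eq, Prod.mk.injEq,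
      add_left_inj] at h
    have := Fin.ext h.2
    simpa using this

theorem position_vertex_lt_edge (p : Placement H) (i : ℕ) (k) :
    p.position (Sum.inl i) < p.position (Sum.inr (p.edge k)) ↔ i ≤ p.gap k := by
  simp [position, Prod.Lex.toLex_lt_toLex, le_iff_lt_or_eq (b := p.gap k)]

theorem position_edge_lt_edge (p : Placement H) (k k') :
    p.position (Sum.inr (p.edge k)) < p.position (Sum.inr (p.edge k')) ↔ k < k' := by
  simp only [position, Sum.elim_inr, Equiv.symm_apply_apply, Prod.Lex.toLex_lt_toLex,
    add_lt_add_iff_right, Fin.val_fin_lt]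
  constructor
  · rintro (h | h)
    · exact lt_of_not_ge fun h' => absurd (p.mono h') (not_le.2 h)
    · exact h.2
  · intro h
    rcases (p.mono h.le).lt_or_eq with h' | h'
    · exact Or.inl h'
    · exact Or.inr ⟨h', h⟩

/-- The extended ordering described by a placement. -/
def toOrdering (p : Placement H) : ExtendedOrdering H where
  val x y := p.position x < p.position y
  property :=
    { strictTotal :=
        { trichotomous := fun x y h1 h2 =>
            p.position_injective (le_antisymm (not_lt.1 h2) (not_lt.1 h1))
          irrefl := fun _ => lt_irrefl _
          trans := fun _ _ _ => lt_trans }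
      vertices := fun i j h => by simpa [position, Prod.Lex.toLex_lt_toLex] using h
      between := fun e => by
        obtain ⟨k, rfl⟩ := p.edge.surjective e
        refine ⟨(p.position_vertex_lt_edge _ _).2 (p.src_le k), ?_⟩
        simpa [position, Prod.Lex.toLex_lt_toLex] using p.lt_tgt k }

theorem toOrdering_vertex_edge (p : Placement H) (i : ℕ) (k) :
    p.toOrdering.1 (Sum.inl i) (Sum.inr (p.edge k)) ↔ i ≤ p.gap k :=
  p.position_vertex_lt_edge i k

theorem toOrdering_edge_edge (p : Placement H) (k k') :
    p.toOrdering.1 (Sum.inr (p.edge k)) (Sum.inr (p.edge k')) ↔ k < k' :=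
  p.position_edge_lt_edge k k'

theorem toOrdering_surjective : Function.Surjective (toOrdering (H := H)) := by
  classical
  rintro ⟨r, hr⟩
  have _ := hr.strictTotal
  have _ : IsStrictTotalOrder H fun e e' => r (Sum.inr e) (Sum.inr e') :=
    { trichotomous := fun e e' h1 h2 => by
        rcases trichotomous_of r (Sum.inr e) (Sum.inr e') with h | h | h
        · exact absurd h h1
        · simpa using h
        · exact absurd h h2
      irrefl := fun e => irrefl_of r _
      trans := fun _ _ _ => trans_of r }
  let _ : LinearOrder H := linearOrderOfSTO fun e e' => r (Sum.inr e) (Sum.inr e')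
  let f : Fin (Multiset.card H) ≃o H := Fintype.orderIsoFinOfCardEq H (Multiset.card_coe H)
  have hf : ∀ k k', r (Sum.inr (f k)) (Sum.inr (f k')) ↔ k < k' := fun k k' => f.lt_iff_lt
  let g : H → ℕ := fun e => Nat.findGreatest (fun i => r (Sum.inl i) (Sum.inr e)) e.1.tgt
  have hlt : ∀ (i : ℕ) (e : H), r (Sum.inl i) (Sum.inr e) → i < e.1.tgt := fun i e h =>
    hr.vertex_lt_iff.1 (trans_of r h (hr.between e).2)
  have hg : ∀ (i : ℕ) (e : H), r (Sum.inl i) (Sum.inr e) ↔ i ≤ g e := by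
    intro i e
    refine ⟨fun h => Nat.le_findGreatest (hlt i e h).le h, fun h => ?_⟩
    have h' : r (Sum.inl (g e)) (Sum.inr e) :=
      Nat.findGreatest_spec (P := fun i => r (Sum.inl i) (Sum.inr e)) e.1.src_lt_tgt.le
        (hr.between e).1
    rcases h.eq_or_lt with rfl | h
    · exact h'
    · exact trans_of r (hr.vertices _ _ h) h'
  refine ⟨⟨f.toEquiv, fun k => g (f k), ?_, fun k => (hg _ _).1 (hr.between _).1,
    fun k => hlt _ _ ((hg _ _).2 le_rfl)⟩, ?_⟩
  · intro k k' hk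
    rcases hk.eq_or_lt with rfl | hk
    · rfl
    · exact (hg _ _).1 (trans_of r ((hg _ _).2 le_rfl) ((hf _ _).2 hk))
  · refine Subtype.ext (IsExtendedOrdering.ext (toOrdering _).2 hr (fun i e => ?_) fun e e' => ?_)
    · obtain ⟨k, rfl⟩ := f.surjective e
      exact (toOrdering_vertex_edge _ i k).trans (hg _ _).symm
    · obtain ⟨k, rfl⟩ := f.surjective e
      obtain ⟨k', rfl⟩ := f.surjective e'
      exact (toOrdering_edge_edge _ k k').trans (hf _ _).symm

/-- Two placements describe equivalent extended orderings if and only if they have the same gaps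
and, in each position, edges with the same endpoints and weight. -/
theorem toOrdering_equiv_iff (p q : Placement H) :
    p.toOrdering ≈ q.toOrdering ↔
      p.gap = q.gap ∧ ∀ k, (p.edge k).1 = (q.edge k).1 := by
  constructor
  · rintro ⟨σ, h1, h2⟩
    -- The bijection `q.edge⁻¹ ∘ σ ∘ p.edge` is an order automorphism of a finite chain.
    have hmono : StrictMono fun k => q.edge.symm (σ (p.edge k)) := by
      intro k k' hk
      rw [← toOrdering_edge_edge p, h2] at hk
      simpa using (toOrdering_edge_edge q (q.edge.symm (σ (p.edge k)))
        (q.edge.symm (σ (p.edge k')))).1 (by simpa using hk)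
    have hid : ∀ k, q.edge k = σ (p.edge k) := by
      intro k
      have hr : Set.range (fun k => q.edge.symm (σ (p.edge k))) = Set.range id := by
        rw [Set.range_id]
        exact ((p.edge.trans σ).trans q.edge.symm).surjective.range_eq
      have := congrFun ((StrictMono.range_inj hmono strictMono_id).1 hr) k
      simp only [id] at this
      exact ((q.edge.symm_apply_eq).1 this).symm
    refine ⟨funext fun k => ?_, fun k => by rw [hid, h1]⟩
    have h3 : ∀ i, i ≤ p.gap k ↔ i ≤ q.gap k := by
      intro i
      rw [← toOrdering_vertex_edge, ← toOrdering_vertex_edge, h2, hid]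
      rfl
    exact le_antisymm ((h3 _).1 le_rfl) ((h3 _).2 le_rfl)
  · rintro ⟨h1, h2⟩
    refine ⟨p.edge.symm.trans q.edge, fun e => ?_, fun x y => ?_⟩
    · have := h2 (p.edge.symm e)
      rw [Equiv.apply_symm_apply] at this
      exact this.symm
    · have h : ∀ z, q.position (Sum.map id (p.edge.symm.trans q.edge) z) = p.position z := by
        rintro (i | e) <;> simp [position, h1]
      change p.position x < p.position y ↔ q.position _ < q.position _
      rw [h, h]

end Placement

/-- The words of gaps and edges: the lists of pairs `(i, e)`, meaning that the edge `e` is put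
between the vertices `i` and `i + 1`, in which the gaps increase weakly, each edge is put between
its endpoints, and the edges form the multiset `H`. -/
def gapWords (H : Multiset WEdge) : Set (List (ℕ × WEdge)) :=
  {l | l.Pairwise (fun a b => a.1 ≤ b.1) ∧ (∀ a ∈ l, a.2.src ≤ a.1 ∧ a.1 < a.2.tgt) ∧
    (l.map Prod.snd : Multiset WEdge) = H}

namespace Placement

variable {H : Multiset WEdge}

/-- The word of a placement. -/
def word (p : Placement H) : List (ℕ × WEdge) := List.ofFn fun k => (p.gap k, (p.edge k).1)

theorem word_eq_iff (p q : Placement H) :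
    p.word = q.word ↔ p.gap = q.gap ∧ ∀ k, (p.edge k).1 = (q.edge k).1 := by
  simp [word, List.ofFn_inj, funext_iff, forall_and]

theorem word_mem (p : Placement H) : p.word ∈ gapWords H := by
  refine ⟨?_, ?_, ?_⟩
  · rw [word, List.pairwise_ofFn]
    exact fun i j h => p.mono h.le
  · intro a ha
    obtain ⟨k, rfl⟩ := (List.mem_ofFn' _ _).1 ha
    exact ⟨p.src_le k, p.lt_tgt k⟩
  · have h : p.word.map Prod.snd = List.ofFn fun k => (p.edge k).1 := by
      rw [word, List.map_ofFn]; rfl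
    rw [h]
    have h1 : ((List.ofFn fun k => (p.edge k).1 : List WEdge) : Multiset WEdge) =
        Finset.univ.val.map fun k => (p.edge k).1 := by
      rw [Fin.univ_val_map]
    have h3 : (Finset.univ.val.map fun k => (p.edge k).1) =
        (Finset.univ.val.map p.edge).map fun e : H => e.1 := by
      rw [Multiset.map_map]; rfl
    rw [h1, h3]
    have h2 : (Finset.univ.val.map p.edge) = (Finset.univ : Finset H).val := by
      rw [← Finset.map_univ_equiv p.edge]; rfl
    rw [h2]
    exact Multiset.map_univ_coe H

theorem exists_word_eq {l : List (ℕ × WEdge)} (hl : l ∈ gapWords H) :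
    ∃ p : Placement H, p.word = l := by
  obtain ⟨h1, h2, h3⟩ := hl
  have hlen : l.length = Multiset.card H := by rw [← h3]; simp
  let v : Fin (Multiset.card H) → ℕ × WEdge := fun k => l.get (k.cast hlen.symm)
  have hv : List.ofFn v = l := by
    apply List.ext_get
    · simp [hlen]
    · intro n _ _; simp [v]
  obtain ⟨f, hf⟩ : ∃ f : Fin (Multiset.card H) ≃ H, ∀ k, (f k).1 = (v k).2 := by
    have hm : Finset.univ.val.map (fun k => (v k).2) =
        (Finset.univ : Finset H).val.map (fun e : H => e.1) := by
      rw [Multiset.map_univ_coe H, Fin.univ_val_map]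
      refine Eq.trans ?_ h3
      conv_rhs => rw [← hv]
      rw [List.map_ofFn]; rfl
    exact exists_equiv_of_map_univ_eq _ _ hm
  refine ⟨⟨f, fun k => (v k).1, ?_, ?_, ?_⟩, ?_⟩
  · rw [← hv, List.pairwise_ofFn] at h1
    intro i j hij
    rcases hij.eq_or_lt with rfl | hij
    · rfl
    · exact h1 hij
  · intro k
    rw [hf]; exact (h2 _ (List.get_mem _ _)).1
  · intro k
    rw [hf]; exact (h2 _ (List.get_mem _ _)).2
  · refine Eq.trans ?_ hv
    rw [word]
    congr 1
    funext k
    exact Prod.ext rfl (hf k)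

end Placement

/-- The extended orderings up to equivalence are counted by words. -/
theorem card_quotient_eq_ncard_gapWords (H : Multiset WEdge) :
    Nat.card (Quotient (ExtendedOrdering.setoid H)) = (gapWords H).ncard := by
  choose s hs using Placement.toOrdering_surjective (H := H)
  have key : ∀ o o' : ExtendedOrdering H, o ≈ o' ↔ (s o).word = (s o').word := fun o o' => by
    rw [Placement.word_eq_iff, ← Placement.toOrdering_equiv_iff, hs, hs]
  let F : Quotient (ExtendedOrdering.setoid H) → gapWords H :=
    Quotient.lift (fun o => ⟨(s o).word, (s o).word_mem⟩)
      fun o o' h => Subtype.ext ((key o o').1 h)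
  refine Nat.card_congr (Equiv.ofBijective F ⟨?_, ?_⟩)
  · rintro ⟨o⟩ ⟨o'⟩ h
    exact Quotient.sound ((key o o').2 (congrArg Subtype.val h))
  · rintro ⟨l, hl⟩
    obtain ⟨p, rfl⟩ := Placement.exists_word_eq hl
    refine ⟨Quotient.mk _ p.toOrdering, Subtype.ext ?_⟩
    refine (Placement.word_eq_iff _ _).2 ((Placement.toOrdering_equiv_iff _ _).1 ?_)
    rw [hs]


/-! ### Cutting words at a vertex -/

/-- If the edges of `H₁` lie to the left of the vertex `m` and those of `H₂` to the right, then the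
words for `H₁ + H₂` are the concatenations of a word for `H₁` and one for `H₂`. -/
theorem ncard_gapWords_add {H₁ H₂ : Multiset WEdge} {m : ℕ} (h₁ : ∀ e ∈ H₁, e.tgt ≤ m)
    (h₂ : ∀ e ∈ H₂, m ≤ e.src) :
    (gapWords (H₁ + H₂)).ncard = (gapWords H₁).ncard * (gapWords H₂).ncard := by
  classical
  have hlt : ∀ l ∈ gapWords H₁, ∀ a ∈ l, a.1 < m := fun l hl a ha =>
    (hl.2.1 a ha).2.trans_le (h₁ _ (by rw [← hl.2.2]; exact List.mem_map_of_mem ha))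
  have hge : ∀ l ∈ gapWords H₂, ∀ a ∈ l, m ≤ a.1 := fun l hl a ha =>
    (h₂ _ (by rw [← hl.2.2]; exact List.mem_map_of_mem ha)).trans (hl.2.1 a ha).1
  rw [← Set.ncard_prod]
  have himage : (fun x : List (ℕ × WEdge) × List (ℕ × WEdge) => x.1 ++ x.2) ''
      gapWords H₁ ×ˢ gapWords H₂ = gapWords (H₁ + H₂) := by
    ext l
    constructor
    · rintro ⟨⟨l₁, l₂⟩, ⟨hl₁, hl₂⟩, rfl⟩
      refine ⟨List.pairwise_append.2 ⟨hl₁.1, hl₂.1, fun a ha b hb =>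
        ((hlt _ hl₁ a ha).trans_le (hge _ hl₂ b hb)).le⟩, fun a ha => ?_, ?_⟩
      · rcases List.mem_append.1 ha with ha | ha
        · exact hl₁.2.1 a ha
        · exact hl₂.2.1 a ha
      · rw [List.map_append, ← Multiset.coe_add, hl₁.2.2, hl₂.2.2]
    · rintro ⟨hl1, hl2, hl3⟩
      set l₁ := l.takeWhile (fun a => a.1 < m) with hl₁
      set l₂ := l.dropWhile (fun a => a.1 < m) with hl₂
      have happ : l₁ ++ l₂ = l := List.takeWhile_append_dropWhile
      have hlt' : ∀ a ∈ l₁, a.1 < m := fun a ha => by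
        simpa using List.mem_takeWhile_imp ha
      have hge' : ∀ a ∈ l₂, m ≤ a.1 := by
        intro a ha
        have hp : l₂.Pairwise (fun a b => a.1 ≤ b.1) := hl1.sublist (List.dropWhile_sublist _)
        have hh := List.head?_dropWhile_not (fun a : ℕ × WEdge => decide (a.1 < m)) l
        rw [← hl₂] at hh
        cases hc : l₂ with
        | nil => rw [hc] at ha; simp at ha
        | cons b l' =>
          rw [hc] at ha hp hh
          have hb : m ≤ b.1 := by simpa using hh
          rcases List.mem_cons.1 ha with rfl | ha
          · exact hb
          · exact hb.trans ((List.pairwise_cons.1 hp).1 a ha)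
      have hmem : ∀ a, a ∈ l₁ ∨ a ∈ l₂ → a ∈ l := fun a h => by rw [← happ]; simpa using h
      -- Both halves are recovered by the condition `e.tgt ≤ m` on edges.
      have hsum : (l₁.map Prod.snd : Multiset WEdge) + (l₂.map Prod.snd : Multiset WEdge) =
          H₁ + H₂ := by
        rw [Multiset.coe_add, ← List.map_append, happ, hl3]
      have hL₁ : ∀ e ∈ (l₁.map Prod.snd : Multiset WEdge), e.tgt ≤ m := by
        intro e he
        obtain ⟨a, ha, rfl⟩ := List.mem_map.1 (Multiset.mem_coe.1 he)
        have h3 : a.2 ∈ H₁ + H₂ := by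
          rw [← hsum]; exact Multiset.mem_add.2 (Or.inl he)
        rcases Multiset.mem_add.1 h3 with h3 | h3
        · exact h₁ _ h3
        · have := h₂ _ h3
          have := hlt' a ha
          have := (hl2 a (hmem a (Or.inl ha))).1
          omega
      have hL₂ : ∀ e ∈ (l₂.map Prod.snd : Multiset WEdge), ¬ e.tgt ≤ m := by
        intro e he
        obtain ⟨a, ha, rfl⟩ := List.mem_map.1 (Multiset.mem_coe.1 he)
        have := hge' a ha
        have := (hl2 a (hmem a (Or.inr ha))).2
        omega
      have hH₂ : ∀ e ∈ H₂, ¬ e.tgt ≤ m := fun e he => by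
        have := h₂ e he
        have := e.src_lt_tgt
        omega
      have e₁ : (l₁.map Prod.snd : Multiset WEdge) = H₁ := by
        have := congrArg (Multiset.filter fun e => e.tgt ≤ m) hsum
        rwa [Multiset.filter_add, Multiset.filter_add, Multiset.filter_eq_self.2 hL₁,
          Multiset.filter_eq_nil.2 hL₂, Multiset.filter_eq_self.2 h₁,
          Multiset.filter_eq_nil.2 hH₂, add_zero, add_zero] at this
      have e₂ : (l₂.map Prod.snd : Multiset WEdge) = H₂ := by
        rw [e₁] at hsum
        exact add_left_cancel hsum
      exact ⟨(l₁, l₂), ⟨⟨hl1.sublist (List.takeWhile_sublist _),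
        fun a ha => hl2 a (hmem a (Or.inl ha)), e₁⟩, ⟨hl1.sublist (List.dropWhile_sublist _),
        fun a ha => hl2 a (hmem a (Or.inr ha)), e₂⟩⟩, happ⟩
  rw [← himage]
  refine Set.InjOn.ncard_image ?_
  rintro ⟨l₁, l₂⟩ ⟨hl₁, hl₂⟩ ⟨k₁, k₂⟩ ⟨hk₁, hk₂⟩ h
  have hlen : ∀ l ∈ gapWords H₁, l.length = Multiset.card H₁ := fun l hl => by
    rw [← hl.2.2]; simp
  obtain ⟨h1, h2⟩ := List.append_inj h ((hlen _ hl₁).trans (hlen _ hk₁).symm)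
  exact Prod.ext h1 h2

/-- A graph with short edges only has exactly one word. -/
theorem ncard_gapWords_of_isShort {H : Multiset WEdge} (h : ∀ e ∈ H, e.IsShort) :
    (gapWords H).ncard = 1 := by
  classical
  -- A short edge fits in a single gap, so the word is the sorted list of edges.
  have hgap : ∀ l ∈ gapWords H, ∀ a ∈ l, a = (a.2.src, a.2) := by
    intro l hl a ha
    have h1 := hl.2.1 a ha
    have h2 := (h a.2 (by rw [← hl.2.2]; exact List.mem_map_of_mem ha)).1
    exact Prod.ext (by simp only; omega) rfl
  have hshort : ∀ l ∈ gapWords H, ∀ a ∈ l, ∀ b ∈ l, a.1 ≤ b.1 → b.1 ≤ a.1 → a = b := by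
    intro l hl a ha b hb h1 h2
    have ha' := h a.2 (by rw [← hl.2.2]; exact List.mem_map_of_mem ha)
    have hb' := h b.2 (by rw [← hl.2.2]; exact List.mem_map_of_mem hb)
    have h3 := hgap l hl a ha
    have h4 := hgap l hl b hb
    have h5 : a.1 = b.1 := le_antisymm h1 h2
    have h6 : a.2.src = b.2.src := by
      rw [h3, h4] at h5; exact h5
    refine Prod.ext h5 (WEdge.ext h6 ?_ ?_)
    · rw [ha'.1, hb'.1, h6]
    · rw [ha'.2, hb'.2]
  have hmap : ∀ l ∈ gapWords H, (l : Multiset (ℕ × WEdge)) = H.map fun e => (e.src, e) := by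
    intro l hl
    rw [← hl.2.2, Multiset.map_coe, List.map_map]
    congr 1
    conv_lhs => rw [← List.map_id l]
    exact List.map_congr_left fun a ha => hgap l hl a ha
  rw [Set.ncard_eq_one]
  let k := (H.map fun e => (e.src, e)).toList.mergeSort (fun a b => decide (a.1 ≤ b.1))
  have hk : (k : Multiset (ℕ × WEdge)) = H.map fun e => (e.src, e) := by
    rw [Multiset.coe_eq_coe.2 (List.mergeSort_perm _ _), Multiset.coe_toList]
  have hsorted : k.Pairwise fun a b => a.1 ≤ b.1 := by
    have := List.pairwise_mergeSort (le := fun a b : ℕ × WEdge => decide (a.1 ≤ b.1))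
      (fun a b c h1 h2 => by simp at *; omega) (fun a b => by simp; omega)
      (H.map fun e => (e.src, e)).toList
    exact this.imp fun h => by simpa using h
  refine ⟨k, Set.eq_singleton_iff_unique_mem.2 ⟨⟨?_, ?_, ?_⟩, ?_⟩⟩
  · exact hsorted
  · intro a ha
    have : a ∈ H.map fun e => (e.src, e) := by rw [← hk]; exact ha
    obtain ⟨e, -, rfl⟩ := Multiset.mem_map.1 this
    exact ⟨le_rfl, e.src_lt_tgt⟩
  · rw [← Multiset.map_coe, hk, Multiset.map_map]
    simp
  · intro l hl
    have hkl : l.Perm k := Multiset.coe_eq_coe.1 ((hmap l hl).trans hk.symm)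
    exact hkl.eq_of_pairwise (le := fun a b => a.1 ≤ b.1)
      (fun a b ha hb => hshort l hl a ha b (hkl.mem_iff.2 hb)) hl.1 hsorted

/-! ### Multiplicativity of the number of extended orderings -/

namespace LongEdgeGraph

theorem maxv_le_iff {G : LongEdgeGraph} {B : ℕ} : G.maxv ≤ B ↔ ∀ e ∈ G, e.1.tgt ≤ B := by
  refine ⟨fun h e he => (tgt_le_maxv he).trans h, fun h => csSup_le' ?_⟩
  rintro i ⟨e, he, hi⟩
  have := h e he
  have := e.1.src_lt_tgt
  rcases hi with hi | hi <;> omega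

theorem lam_add (j : ℕ) (G₁ G₂ : LongEdgeGraph) : (G₁ + G₂).lam j = G₁.lam j + G₂.lam j := by
  simp [lam]

theorem lam_eq_zero {j : ℕ} {G : LongEdgeGraph} (h : ∀ e ∈ G, ¬ (e.1.src < j ∧ j ≤ e.1.tgt)) :
    G.lam j = 0 := by
  rw [lam, Multiset.filter_eq_nil.2 h]
  simp

theorem lam_zero (j : ℕ) : (0 : LongEdgeGraph).lam j = 0 :=
  lam_eq_zero (by simp)

variable {M : ℕ} (β : Fin (M + 1) → ℕ)

theorem P_zero : P β 0 = 1 := by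
  have h : (0 : LongEdgeGraph).Allowable β :=
    ⟨maxv_le_iff.2 (by simp), fun j => by rw [lam_zero]; exact Nat.zero_le _⟩
  rw [P, if_pos h, card_quotient_eq_ncard_gapWords]
  refine ncard_gapWords_of_isShort fun e he => ?_
  simp only [extGraph, Multiset.map_zero, zero_add, Multiset.mem_sum] at he
  obtain ⟨j, -, he⟩ := he
  rw [Multiset.eq_of_mem_replicate he]
  exact ⟨rfl, rfl⟩

variable {β} in
theorem allowable_add_iff {G₁ G₂ : LongEdgeGraph} {m : ℕ} (h₁ : ∀ e ∈ G₁, e.1.tgt ≤ m)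
    (h₂ : ∀ e ∈ G₂, m ≤ e.1.src) :
    (G₁ + G₂).Allowable β ↔ G₁.Allowable β ∧ G₂.Allowable β := by
  simp only [Allowable, maxv_le_iff, lam_add, Multiset.mem_add]
  constructor
  · rintro ⟨h, h'⟩
    exact ⟨⟨fun e he => h e (Or.inl he), fun j => (Nat.le_add_right _ _).trans (h' j)⟩,
      ⟨fun e he => h e (Or.inr he), fun j => (Nat.le_add_left _ _).trans (h' j)⟩⟩
  · rintro ⟨⟨ha, ha'⟩, ⟨hb, hb'⟩⟩
    refine ⟨fun e he => he.elim (ha e) (hb e), fun j => ?_⟩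
    by_cases hj : (j : ℕ) < m
    · rw [lam_eq_zero (G := G₂) fun e he => by have := h₂ e he; omega, add_zero]
      exact ha' j
    · rw [lam_eq_zero (G := G₁) fun e he => by have := h₁ e he; omega, zero_add]
      exact hb' j

/-- If the edges of `G₁` lie to the left of a vertex and those of `G₂` to the right of it, then the
extended orderings of `G₁ + G₂` are built independently on both sides. -/
theorem P_add {G₁ G₂ : LongEdgeGraph} {m : ℕ} (h₁ : ∀ e ∈ G₁, e.1.tgt ≤ m)
    (h₂ : ∀ e ∈ G₂, m ≤ e.1.src) : P β (G₁ + G₂) = P β G₁ * P β G₂ := by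
  by_cases h : G₁.Allowable β ∧ G₂.Allowable β
  swap
  · rw [P, if_neg (mt (allowable_add_iff h₁ h₂).1 h)]
    by_cases h' : G₁.Allowable β
    · rw [P.eq_1 β G₂, if_neg fun h'' => h ⟨h', h''⟩, mul_zero]
    · rw [P.eq_1 β G₁, if_neg h', zero_mul]
  rw [P, if_pos ((allowable_add_iff h₁ h₂).2 h), P, if_pos h.1, P, if_pos h.2]
  simp only [card_quotient_eq_ncard_gapWords]
  let L : Finset (Fin (M + 1)) := Finset.univ.filter fun j => (j : ℕ) < m
  let R : Finset (Fin (M + 1)) := Finset.univ.filter fun j => ¬ (j : ℕ) < m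
  -- The short edges of `ext_β(G)` in the gaps belonging to `s`.
  let S (s : Finset (Fin (M + 1))) (G : LongEdgeGraph) : Multiset WEdge :=
    ∑ j ∈ s, Multiset.replicate (β j - G.lam (j + 1)) (WEdge.short j)
  have hext : ∀ G : LongEdgeGraph, G.extGraph β = G.map Subtype.val + (S L G + S R G) := by
    intro G
    rw [extGraph, ← Finset.sum_filter_add_sum_filter_not Finset.univ
      fun j : Fin (M + 1) => (j : ℕ) < m]
  have hmemS : ∀ {s G e}, e ∈ S s G → ∃ j ∈ s, e = WEdge.short j := by
    intro s G e he
    obtain ⟨j, hj, he⟩ := Multiset.mem_sum.1 he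
    exact ⟨j, hj, Multiset.eq_of_mem_replicate he⟩
  have hSshort : ∀ {s G}, ∀ e ∈ S s G, e.IsShort := by
    intro s G e he
    obtain ⟨j, -, rfl⟩ := hmemS he
    exact ⟨rfl, rfl⟩
  have hSL : ∀ {G}, ∀ e ∈ S L G, e.tgt ≤ m := by
    intro G e he
    obtain ⟨j, hj, rfl⟩ := hmemS he
    exact (Finset.mem_filter.1 hj).2
  have hSR : ∀ {G}, ∀ e ∈ S R G, m ≤ e.src := by
    intro G e he
    obtain ⟨j, hj, rfl⟩ := hmemS he
    exact not_lt.1 (Finset.mem_filter.1 hj).2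
  have hlam₁ : ∀ j ∈ R, G₁.lam (j + 1) = 0 := fun j hj => lam_eq_zero fun e he => by
    have := h₁ e he
    have := (Finset.mem_filter.1 hj).2
    omega
  have hlam₂ : ∀ j ∈ L, G₂.lam (j + 1) = 0 := fun j hj => lam_eq_zero fun e he => by
    have := h₂ e he
    have := (Finset.mem_filter.1 hj).2
    omega
  have hA : S L (G₁ + G₂) = S L G₁ :=
    Finset.sum_congr rfl fun j hj => by rw [lam_add, hlam₂ j hj, add_zero]
  have hB : S R (G₁ + G₂) = S R G₂ :=
    Finset.sum_congr rfl fun j hj => by rw [lam_add, hlam₁ j hj, zero_add]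
  have hL : ∀ e ∈ G₁.map Subtype.val + S L G₁, e.tgt ≤ m := by
    intro e he
    rcases Multiset.mem_add.1 he with he | he
    · obtain ⟨e', he', rfl⟩ := Multiset.mem_map.1 he
      exact h₁ e' he'
    · exact hSL e he
  have hR : ∀ e ∈ G₂.map Subtype.val + S R G₂, m ≤ e.src := by
    intro e he
    rcases Multiset.mem_add.1 he with he | he
    · obtain ⟨e', he', rfl⟩ := Multiset.mem_map.1 he
      exact h₂ e' he'
    · exact hSR e he
  have e₀ : (G₁ + G₂).extGraph β =
      (G₁.map Subtype.val + S L G₁) + (G₂.map Subtype.val + S R G₂) := by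
    rw [hext, hA, hB, Multiset.map_add]
    abel
  have e₁ : G₁.extGraph β = (G₁.map Subtype.val + S L G₁) + S R G₁ := by
    rw [hext, add_assoc]
  have e₂ : G₂.extGraph β = S L G₂ + (G₂.map Subtype.val + S R G₂) := by
    rw [hext]
    abel
  rw [e₀, e₁, e₂, ncard_gapWords_add hL hR, ncard_gapWords_add hL hSR,
    ncard_gapWords_add hSL hR, ncard_gapWords_of_isShort (H := S R G₁) hSshort,
    ncard_gapWords_of_isShort (H := S L G₂) hSshort, mul_one, one_mul]

end LongEdgeGraph

/-! ### The logarithm in several variables -/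

namespace MvPowerSeries

variable {σ : Type*}

/-- The derivation of a power series ring multiplying each monomial by its weight, for an additive
weight on the exponents. -/
noncomputable def weightDerivation (w : (σ →₀ ℕ) →+ ℕ) :
    Derivation ℚ (MvPowerSeries σ ℚ) (MvPowerSeries σ ℚ) :=
  Derivation.mk'
    { toFun := fun f d => (w d : ℚ) * coeff d f
      map_add' := fun f g => by
        ext d
        exact mul_add _ _ _
      map_smul' := fun c f => by
        ext d
        exact mul_left_comm _ _ _ }
    (by
      classical
      intro f g
      ext d
      change (w d : ℚ) * coeff d (f * g) = coeff d (f • _) + coeff d (g • _)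
      rw [smul_eq_mul, smul_eq_mul, mul_comm g, coeff_mul, coeff_mul, coeff_mul, Finset.mul_sum,
        ← Finset.sum_add_distrib]
      refine Finset.sum_congr rfl fun x hx => ?_
      rw [← Finset.HasAntidiagonal.mem_antidiagonal.1 hx, map_add]
      change _ = _ * ((w x.2 : ℚ) * coeff x.2 g) + (w x.1 : ℚ) * coeff x.1 f * _
      push_cast
      ring)

theorem coeff_weightDerivation (w : (σ →₀ ℕ) →+ ℕ) (f : MvPowerSeries σ ℚ) (d : σ →₀ ℕ) :
    coeff d (weightDerivation w f) = w d * coeff d f := rfl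

/-- The truncation `∑_{n = 1}^N (-1)^(n+1)/n f^n` of `log (1 + f)`. -/
noncomputable def logPartialSum (f : MvPowerSeries σ ℚ) (N : ℕ) : MvPowerSeries σ ℚ :=
  ∑ n ∈ Finset.Icc 1 N, ((-1 : ℚ) ^ (n + 1) / n) • f ^ n

theorem one_add_mul_derivation_logPartialSum
    (D : Derivation ℚ (MvPowerSeries σ ℚ) (MvPowerSeries σ ℚ)) (f : MvPowerSeries σ ℚ) (N : ℕ) :
    (1 + f) * D (logPartialSum f N) = D f - (-f) ^ N * D f := by
  induction N with
  | zero => simp [logPartialSum]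
  | succ N ih =>
    have h : D (logPartialSum f (N + 1)) = D (logPartialSum f N) + (-f) ^ N * D f := by
      rw [logPartialSum, Finset.sum_Icc_succ_top (by omega), map_add, ← logPartialSum,
        D.map_smul, D.leibniz_pow, Nat.add_sub_cancel, smul_eq_mul, ← Nat.cast_smul_eq_nsmul ℚ,
        smul_smul, div_mul_cancel₀ _ (by positivity), neg_pow f, mul_assoc, pow_add (-1 : ℚ)]
      congr 1
      rcases Nat.even_or_odd N with hN | hN
      · simp [pow_add, hN.neg_one_pow]
      · simp [pow_add, hN.neg_one_pow]
    rw [h, mul_add, ih, pow_succ]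
    ring

theorem coeff_pow_mul_eq_zero {f : MvPowerSeries σ ℚ} (hf : constantCoeff f = 0)
    (g : MvPowerSeries σ ℚ) {N : ℕ} {d : σ →₀ ℕ} (hd : d.degree < N) :
    coeff d (f ^ N * g) = 0 := by
  apply coeff_of_lt_order
  calc (d.degree : ℕ∞) < N := by exact_mod_cast hd
    _ ≤ (f ^ N).order := le_order_pow_of_constantCoeff_eq_zero N hf
    _ ≤ (f ^ N).order + g.order := le_self_add
    _ ≤ _ := le_order_mul

end MvPowerSeries

/-! ### The recursion for `Φ` -/

namespace LongEdgeGraph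

variable {M : ℕ} (β : Fin (M + 1) → ℕ)

/-- The generating function of `P_β(G)` over nonempty graphs, in one variable for each possible
edge. -/
noncomputable def genP : MvPowerSeries LongEdge ℚ :=
  fun d => if d = 0 then 0 else (P β (Finsupp.toMultiset d) : ℚ)

theorem coeff_genP (G : LongEdgeGraph) :
    MvPowerSeries.coeff (Multiset.toFinsupp G) (genP β) = if G = 0 then 0 else (P β G : ℚ) := by
  change (if Multiset.toFinsupp G = 0 then 0 else _) = _
  simp

theorem coeff_one_add_genP (G : LongEdgeGraph) :
    MvPowerSeries.coeff (Multiset.toFinsupp G) (1 + genP β : MvPowerSeries LongEdge ℚ) =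
      (P β G : ℚ) := by
  classical
  rw [map_add, coeff_genP, MvPowerSeries.coeff_one]
  rcases eq_or_ne G 0 with rfl | h
  · simp [P_zero]
  · simp [h]

theorem coeff_genP_pow (G : LongEdgeGraph) (n : ℕ) :
    MvPowerSeries.coeff (Multiset.toFinsupp G) (genP β ^ n) =
      ∑ p ∈ partitions n G, ∏ j, ((p j).P β : ℚ) := by
  classical
  have h : genP β ^ n = ∏ _j : Fin n, genP β := by simp
  rw [h, MvPowerSeries.coeff_prod]
  symm
  refine Finset.sum_of_injOn
    (fun p => Finsupp.equivFunOnFinite.symm fun j => Multiset.toFinsupp (p j)) ?_ ?_ ?_ ?_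
  · intro p _ q _ hpq
    funext j
    exact Multiset.toFinsupp.injective (DFunLike.congr_fun hpq j)
  · intro p hp
    have hp := (mem_partitions.1 hp).2
    simp only [Finset.mem_coe, Finset.mem_finsuppAntidiag, Finset.subset_univ, and_true]
    rw [← hp, map_sum]
    rfl
  · intro l hl hl'
    rw [Finset.mem_finsuppAntidiag] at hl
    by_cases h0 : ∃ j, l j = 0
    · obtain ⟨j, hj⟩ := h0
      refine Finset.prod_eq_zero (Finset.mem_univ j) ?_
      rw [hj]
      simp [genP, MvPowerSeries.coeff_apply]
    · push Not at h0
      refine absurd ⟨fun j => Finsupp.toMultiset (l j), ?_, ?_⟩ hl'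
      · refine Finset.mem_coe.2 (mem_partitions.2 ⟨fun j => ?_, ?_⟩)
        · exact fun h => h0 j (by simpa using congrArg Multiset.toFinsupp h)
        · rw [← map_sum, hl.1]
          simp
      · ext j
        simp
  · intro p hp
    have hp := (mem_partitions.1 hp).1
    refine Finset.prod_congr rfl fun j _ => ?_
    have := coeff_genP β (p j)
    rw [if_neg (hp j)] at this
    exact this.symm

theorem coeff_logPartialSum (G : LongEdgeGraph) {N : ℕ} (hN : Multiset.card G ≤ N) :
    MvPowerSeries.coeff (Multiset.toFinsupp G) (MvPowerSeries.logPartialSum (genP β) N) =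
      Phi β G := by
  rw [MvPowerSeries.logPartialSum, map_sum, Phi]
  symm
  refine (Finset.sum_subset (Finset.Icc_subset_Icc_right hN) fun n hn hn' => ?_).trans
    (Finset.sum_congr rfl fun n _ => by rw [map_smul, coeff_genP_pow, smul_eq_mul])
  have : partitions n G = ∅ := Finset.eq_empty_of_forall_notMem fun p hp => by
    have := card_le_of_mem_partitions hp
    simp only [Finset.mem_Icc] at hn hn'
    omega
  rw [this, Finset.sum_empty, mul_zero]

/-- The logarithmic derivative: `Φ_β` is the logarithm of `P_β` with respect to disjoint union, so
that `w P = P * (w Φ)` for every additive weight `w`. -/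
theorem weight_mul_P (w : LongEdgeGraph →+ ℕ) (G : LongEdgeGraph) :
    (w G : ℚ) * P β G = ∑ B ∈ Finset.Iic G, (P β (G - B) : ℚ) * (w B * Phi β B) := by
  classical
  let w' : (LongEdge →₀ ℕ) →+ ℕ := w.comp Finsupp.toMultiset
  have hw' : ∀ A : LongEdgeGraph, w' (Multiset.toFinsupp A) = w A := fun A => by simp [w']
  have hdeg : (Multiset.toFinsupp G).degree = Multiset.card G := by
    have := Finsupp.card_toMultiset (Multiset.toFinsupp G)
    rw [Multiset.toFinsupp_toMultiset] at this
    rw [this]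
    rfl
  have h0 : MvPowerSeries.constantCoeff (-genP β) = 0 := by
    have := coeff_genP β 0
    simpa using this
  have key := congrArg (MvPowerSeries.coeff (Multiset.toFinsupp G))
    (MvPowerSeries.one_add_mul_derivation_logPartialSum (MvPowerSeries.weightDerivation w')
      (genP β) (Multiset.card G + 1))
  rw [map_sub, MvPowerSeries.coeff_pow_mul_eq_zero h0 _ (by omega), sub_zero,
    MvPowerSeries.coeff_weightDerivation, coeff_genP, hw', MvPowerSeries.coeff_mul] at key
  have hlhs : (w G : ℚ) * (if G = 0 then 0 else (P β G : ℚ)) = w G * P β G := by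
    rcases eq_or_ne G 0 with rfl | h
    · simp
    · rw [if_neg h]
  rw [← hlhs, ← key]
  symm
  refine Finset.sum_bij (fun B _ => (Multiset.toFinsupp (G - B), Multiset.toFinsupp B))
    ?_ ?_ ?_ ?_
  · intro B hB
    rw [Finset.HasAntidiagonal.mem_antidiagonal, ← map_add,
      tsub_add_cancel_of_le (Finset.mem_Iic.1 hB)]
  · intro B _ B' _ h
    exact Multiset.toFinsupp.injective (Prod.ext_iff.1 h).2
  · rintro ⟨a, b⟩ h
    rw [Finset.HasAntidiagonal.mem_antidiagonal] at h
    have h' : Finsupp.toMultiset a + Finsupp.toMultiset b = G := by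
      rw [← map_add, h, Multiset.toFinsupp_toMultiset]
    refine ⟨Finsupp.toMultiset b, Finset.mem_Iic.2 ?_, ?_⟩
    · rw [← h']; exact Multiset.le_add_left _ _
    · rw [← h', Multiset.add_sub_cancel_right]
      simp
  · intro B hB
    have hBG := Multiset.card_le_card (Finset.mem_Iic.1 hB)
    rw [coeff_one_add_genP, MvPowerSeries.coeff_weightDerivation, hw',
      coeff_logPartialSum _ _ (by omega)]

/-- `Φ_β` vanishes on graphs that fall into two nonempty pieces on both sides of a vertex, by
multiplicativity of `P_β`. -/
theorem Phi_add_eq_zero {G₁ G₂ : LongEdgeGraph} {m : ℕ} (h₁ : ∀ e ∈ G₁, e.1.tgt ≤ m)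
    (h₂ : ∀ e ∈ G₂, m ≤ e.1.src) (n₁ : G₁ ≠ 0) (n₂ : G₂ ≠ 0) : Phi β (G₁ + G₂) = 0 := by
  classical
  -- The weight counting the edges to the left of `m`.
  let w : LongEdgeGraph →+ ℕ :=
    { toFun := fun G => Multiset.countP (fun e => e.1.tgt ≤ m) G
      map_zero' := by simp
      map_add' := fun A B => by simp }
  have hw : ∀ {A : LongEdgeGraph}, (∀ e ∈ A, m ≤ e.1.src) → w A = 0 := fun {A} hA =>
    Multiset.countP_eq_zero.2 fun e he => by
      have := hA e he
      have := e.1.src_lt_tgt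
      omega
  induction hc : Multiset.card (G₁ + G₂) using Nat.strong_induction_on generalizing G₁ G₂ with
  | _ c ih =>
  have hG := weight_mul_P β w (G₁ + G₂)
  have hG₁ := weight_mul_P β w G₁
  have hsplit : ∑ B ∈ Finset.Iic (G₁ + G₂), (P β (G₁ + G₂ - B) : ℚ) * (w B * Phi β B) =
      w (G₁ + G₂) * Phi β (G₁ + G₂) +
        ∑ B ∈ Finset.Iic G₁, (P β (G₁ + G₂ - B) : ℚ) * (w B * Phi β B) := by
    have hnot : G₁ + G₂ ∉ Finset.Iic G₁ := by
      rw [Finset.mem_Iic]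
      intro h
      have := Multiset.card_le_card h
      rw [Multiset.card_add] at this
      have := Multiset.card_pos.2 n₂
      omega
    have : (P β (G₁ + G₂ - (G₁ + G₂)) : ℚ) = 1 := by simp [P_zero]
    rw [← one_mul ((w (G₁ + G₂) : ℚ) * _), ← this, ← Finset.sum_insert
      (f := fun B => (P β (G₁ + G₂ - B) : ℚ) * (w B * Phi β B)) hnot]
    symm
    refine Finset.sum_subset ?_ fun B hB hB' => ?_
    · intro B hB
      rw [Finset.mem_Iic]
      rcases Finset.mem_insert.1 hB with rfl | hB
      · exact le_rfl
      · exact (Finset.mem_Iic.1 hB).trans (Multiset.le_add_right _ _)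
    · rw [Finset.mem_Iic] at hB
      rw [Finset.mem_insert, not_or, Finset.mem_Iic] at hB'
      have hmem : ∀ e ∈ B, e ∈ G₁ ∨ e ∈ G₂ := fun e he =>
        Multiset.mem_add.1 (Multiset.mem_of_le hB he)
      set B₁ := B.filter fun e => e.1.tgt ≤ m with hB₁
      set B₂ := B.filter fun e => ¬ e.1.tgt ≤ m with hB₂
      have hBB : B₁ + B₂ = B := Multiset.filter_add_not _ _
      have k₁ : ∀ e ∈ B₁, e.1.tgt ≤ m := fun e he => (Multiset.mem_filter.1 he).2
      have k₂ : ∀ e ∈ B₂, m ≤ e.1.src := fun e he => by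
        obtain ⟨he, he'⟩ := Multiset.mem_filter.1 he
        exact (hmem e he).elim (fun h => absurd (h₁ e h) he') (h₂ e)
      have z₂ : B₂ ≠ 0 := by
        intro h
        refine hB'.2 ?_
        rw [h, add_zero] at hBB
        rw [← hBB, Multiset.le_iff_count]
        intro e
        by_cases he : e ∈ B₁
        · have hle := Multiset.count_le_of_le e hB
          have : e ∉ G₂ := fun h => by
            have := h₂ e h
            have := k₁ e he
            have := e.1.src_lt_tgt
            omega
          rw [Multiset.count_add, Multiset.count_eq_zero_of_notMem this, add_zero] at hle
          rwa [hBB]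
        · rw [Multiset.count_eq_zero_of_notMem he]
          exact Nat.zero_le _
      by_cases z₁ : B₁ = 0
      · rw [z₁, zero_add] at hBB
        rw [hw (hBB ▸ k₂)]
        simp
      · have hlt : Multiset.card B < c := by
          rw [← hc]
          exact Multiset.card_lt_card (lt_of_le_of_ne hB hB'.1)
        have := ih _ hlt k₁ k₂ z₁ z₂ (by rw [hBB])
        rw [hBB] at this
        rw [this]
        simp
  have hsum : ∑ B ∈ Finset.Iic G₁, (P β (G₁ + G₂ - B) : ℚ) * (w B * Phi β B) =
      w G₁ * P β G₁ * P β G₂ := by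
    rw [hG₁, Finset.sum_mul]
    refine Finset.sum_congr rfl fun B hB => ?_
    have hB := Finset.mem_Iic.1 hB
    rw [tsub_add_eq_add_tsub hB |>.symm, P_add β (m := m)
      (fun e he => h₁ e (Multiset.mem_of_le (Multiset.sub_le_self _ _) he)) h₂]
    push_cast
    ring
  rw [hsplit, hsum, P_add β h₁ h₂, map_add, hw h₂] at hG
  have hpos : (w G₁ : ℚ) ≠ 0 := by
    obtain ⟨e, he⟩ := Multiset.exists_mem_of_ne_zero n₁
    have : 0 < w G₁ := Multiset.countP_pos.2 ⟨e, he, h₁ e he⟩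
    exact_mod_cast this.ne'
  have : (w G₁ : ℚ) * Phi β (G₁ + G₂) = 0 := by
    push_cast at hG
    simp only [add_zero] at hG
    linarith
  exact (mul_eq_zero.1 this).resolve_left hpos

end LongEdgeGraph

/-! ### The logarithm of the generating function `𝒩` -/

theorem PowerSeries.mul_derivative_logOf {A : Type*} [CommRing A] [Algebra ℚ A]
    {f : PowerSeries A} (hf : PowerSeries.constantCoeff f = 1) :
    f * PowerSeries.derivative A (PowerSeries.logOf f) = PowerSeries.derivative A f := by
  have hs : PowerSeries.HasSubst (f - 1) :=
    PowerSeries.HasSubst.of_constantCoeff_zero' (by simp [hf])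
  have hgeom : (1 + PowerSeries.X) * PowerSeries.derivative A (PowerSeries.log A) = 1 := by
    rw [PowerSeries.deriv_log]
    ext n
    rw [add_mul, one_mul, map_add]
    cases n with
    | zero => simp
    | succ n =>
      rw [PowerSeries.coeff_succ_X_mul, PowerSeries.coeff_mk, PowerSeries.coeff_mk,
        PowerSeries.coeff_one, if_neg (Nat.succ_ne_zero n), ← map_add, pow_succ]
      simp
  have h := congrArg (PowerSeries.subst (f - 1)) hgeom
  rw [← PowerSeries.coe_substAlgHom hs, map_mul, map_add, map_one, PowerSeries.coe_substAlgHom hs,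
    PowerSeries.subst_X hs, add_sub_cancel] at h
  rw [PowerSeries.logOf_eq, PowerSeries.derivative_subst hs, ← mul_assoc, h, one_mul, map_sub]
  simp

namespace LongEdgeGraph

theorem mult_add (A B : LongEdgeGraph) : (A + B).mult = A.mult * B.mult := by
  simp [mult]

/-- The cogenus as an additive map. -/
def cogenusHom : LongEdgeGraph →+ ℕ where
  toFun := cogenus
  map_zero' := by simp [cogenus]
  map_add' A B := by simp [cogenus]

theorem cogenus_add (A B : LongEdgeGraph) : (A + B).cogenus = A.cogenus + B.cogenus :=
  cogenusHom.map_add A B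

theorem cogenus_eq_zero {G : LongEdgeGraph} : G.cogenus = 0 ↔ G = 0 := by
  refine ⟨fun h => Multiset.eq_zero_of_forall_notMem fun e he => ?_, fun h => by
    rw [h]; exact cogenusHom.map_zero⟩
  have h1 := one_le_term e
  have h2 : e.1.len * e.1.wt - 1 ≤ G.cogenus :=
    Multiset.single_le_sum (fun _ _ => Nat.zero_le _) _
      (Multiset.mem_map_of_mem (fun e : LongEdge => e.1.len * e.1.wt - 1) he)
  omega

/-- The graphs meeting the conditions of strict `β`-allowability, for `β = (β_0, …, β_M)`, that do
not depend on the values of `β`: all edges end at `M + 1` or before, and those incident to `0` or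
`M + 1` have weight `1`. -/
def FitsStrictly (M : ℕ) (G : LongEdgeGraph) : Prop :=
  ∀ e ∈ G, e.1.tgt ≤ M + 1 ∧ (e.1.Incident 0 ∨ e.1.Incident (M + 1) → e.1.wt = 1)

theorem fitsStrictly_add {M : ℕ} {A B : LongEdgeGraph} :
    (A + B).FitsStrictly M ↔ A.FitsStrictly M ∧ B.FitsStrictly M := by
  simp only [FitsStrictly, Multiset.mem_add, or_imp, forall_and]
  tauto

theorem finite_fitsStrictly (M δ : ℕ) :
    {G : LongEdgeGraph | G.cogenus = δ ∧ G.FitsStrictly M}.Finite :=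
  (finite_cogenus_maxv δ (M + 1)).subset fun _ hG =>
    ⟨hG.1, maxv_le_iff.2 fun e he => (hG.2 e he).1⟩

/-- The finitely many graphs of cogenus `δ` that may contribute to `N^δ_β`. -/
noncomputable def fitting (M δ : ℕ) : Finset LongEdgeGraph := (finite_fitsStrictly M δ).toFinset

theorem mem_fitting {M δ : ℕ} {G : LongEdgeGraph} :
    G ∈ fitting M δ ↔ G.cogenus = δ ∧ G.FitsStrictly M := by
  simp [fitting]

variable {M : ℕ} (β : Fin (M + 1) → ℕ)

theorem Ps_of_fitsStrictly {G : LongEdgeGraph} (h : G.FitsStrictly M) : G.Ps β = G.P β := by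
  rw [Ps]
  split_ifs with hs
  · rfl
  · refine (if_neg fun ha => hs ⟨ha, fun e he => (h e he).2⟩).symm

theorem Ps_of_not_fitsStrictly {G : LongEdgeGraph} (h : ¬ G.FitsStrictly M) : G.Ps β = 0 :=
  if_neg fun hs => h fun e he => ⟨(tgt_le_maxv he).trans hs.1.1, hs.2 e he⟩

theorem N_eq_sum (δ : ℕ) : N β δ = ∑ G ∈ fitting M δ, (G.P β : ℚ[T;T⁻¹]) * G.mult := by
  have h : N β δ = ∑ᶠ G ∈ {G : LongEdgeGraph | G.cogenus = δ}, (G.Ps β : ℚ[T;T⁻¹]) * G.mult :=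
    finsum_set_coe_eq_finsum_mem (f := fun G : LongEdgeGraph => (G.Ps β : ℚ[T;T⁻¹]) * G.mult)
      {G : LongEdgeGraph | G.cogenus = δ}
  rw [h, finsum_mem_eq_sum_of_inter_support_eq (t := fitting M δ)]
  · refine Finset.sum_congr rfl fun G hG => ?_
    rw [Ps_of_fitsStrictly β (mem_fitting.1 hG).2]
  · ext G
    simp only [Set.mem_inter_iff, Set.mem_ofPred_eq, Finset.mem_coe, mem_fitting,
      Function.mem_support]
    constructor
    · rintro ⟨h1, h2⟩
      refine ⟨⟨h1, ?_⟩, h2⟩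
      by_contra h
      rw [Ps_of_not_fitsStrictly β h] at h2
      simp at h2
    · rintro ⟨h1, h2⟩
      exact ⟨h1.1, h2⟩

/-- The coefficient of `t^δ` in `log 𝒩`, as a sum over graphs: see `Q_eq_logCoeff`. -/
noncomputable def logCoeff (δ : ℕ) : ℚ[T;T⁻¹] :=
  ∑ G ∈ fitting M δ, LaurentPolynomial.C (G.Phi β) * G.mult

theorem logCoeff_zero : logCoeff β 0 = 0 := by
  refine Finset.sum_eq_zero fun G hG => ?_
  rw [cogenus_eq_zero.1 (mem_fitting.1 hG).1]
  simp [Phi]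

theorem N_zero : N β 0 = 1 := by
  have h : fitting M 0 = {0} := by
    ext G
    rw [mem_fitting, cogenus_eq_zero, Finset.mem_singleton, and_iff_left_iff_imp]
    rintro rfl
    simp [FitsStrictly]
  rw [N_eq_sum, h, Finset.sum_singleton, P_zero]
  simp [mult]

/-- The recursion for `Φ_β` with respect to the cogenus, summed over all graphs. -/
theorem mul_N_eq_sum (δ : ℕ) :
    (δ : ℚ[T;T⁻¹]) * N β δ =
      ∑ x ∈ Finset.HasAntidiagonal.antidiagonal δ, N β x.1 * (x.2 * logCoeff β x.2) := by
  have hl : (δ : ℚ[T;T⁻¹]) * N β δ = ∑ G ∈ fitting M δ, ∑ B ∈ Finset.Iic G,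
      ((G - B).P β : ℚ[T;T⁻¹]) * (G - B).mult *
        (B.cogenus * (LaurentPolynomial.C (B.Phi β) * B.mult)) := by
    rw [N_eq_sum, Finset.mul_sum]
    refine Finset.sum_congr rfl fun G hG => ?_
    have h := congrArg LaurentPolynomial.C (weight_mul_P β cogenusHom G)
    rw [map_mul, map_sum, map_natCast, map_natCast] at h
    rw [← (mem_fitting.1 hG).1, ← mul_assoc]
    change (G.cogenus : ℚ[T;T⁻¹]) * _ = _ at h
    rw [h, Finset.sum_mul]
    refine Finset.sum_congr rfl fun B hB => ?_
    rw [map_mul, map_mul, map_natCast, map_natCast]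
    conv_lhs => rw [← tsub_add_cancel_of_le (Finset.mem_Iic.1 hB), mult_add]
    rw [Multiset.add_sub_cancel_right]
    change (_ : ℚ[T;T⁻¹]) * ((B.cogenus : ℚ[T;T⁻¹]) * _) * _ = _
    ring
  have hr : ∑ x ∈ Finset.HasAntidiagonal.antidiagonal δ, N β x.1 * (x.2 * logCoeff β x.2) =
      ∑ x ∈ Finset.HasAntidiagonal.antidiagonal δ, ∑ y ∈ fitting M x.1 ×ˢ fitting M x.2,
        (y.1.P β : ℚ[T;T⁻¹]) * y.1.mult *
          (y.2.cogenus * (LaurentPolynomial.C (y.2.Phi β) * y.2.mult)) := by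
    refine Finset.sum_congr rfl fun x _ => ?_
    rw [N_eq_sum, logCoeff, Finset.mul_sum, Finset.sum_mul_sum, ← Finset.sum_product']
    refine Finset.sum_congr rfl fun y hy => ?_
    rw [(mem_fitting.1 (Finset.mem_product.1 hy).2).1]
  rw [hl, hr, Finset.sum_sigma', Finset.sum_sigma']
  refine Finset.sum_bij' (fun x _ => ⟨((x.1 - x.2).cogenus, x.2.cogenus), (x.1 - x.2, x.2)⟩)
    (fun x _ => ⟨x.2.1 + x.2.2, x.2.2⟩) ?_ ?_ ?_ ?_ ?_
  · rintro ⟨G, B⟩ h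
    simp only [Finset.mem_sigma, mem_fitting, Finset.mem_Iic] at h
    have hGB := tsub_add_cancel_of_le h.2
    have h2 := h.1.2
    rw [← hGB, fitsStrictly_add] at h2
    simp only [Finset.mem_sigma, Finset.HasAntidiagonal.mem_antidiagonal, Finset.mem_product,
      mem_fitting,
      true_and, ← cogenus_add, hGB, h.1.1]
    exact h2
  · rintro ⟨⟨a, b⟩, ⟨A, B⟩⟩ h
    simp only [Finset.mem_sigma, Finset.HasAntidiagonal.mem_antidiagonal, Finset.mem_product,
      mem_fitting] at h
    obtain ⟨h1, ⟨rfl, h2⟩, ⟨rfl, h3⟩⟩ := h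
    simp only [Finset.mem_sigma, mem_fitting, Finset.mem_Iic, cogenus_add, fitsStrictly_add]
    exact ⟨⟨h1, h2, h3⟩, Multiset.le_add_left _ _⟩
  · rintro ⟨G, B⟩ h
    simp only [Finset.mem_sigma, Finset.mem_Iic] at h
    simp [tsub_add_cancel_of_le h.2]
  · rintro ⟨⟨a, b⟩, ⟨A, B⟩⟩ h
    simp only [Finset.mem_sigma, Finset.mem_product, mem_fitting] at h
    obtain ⟨-, ⟨rfl, -⟩, ⟨rfl, -⟩⟩ := h
    simp
  · rintro ⟨G, B⟩ _
    rfl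

theorem Q_eq_logCoeff (δ : ℕ) : Q β δ = logCoeff β δ := by
  have hcoeff : ∀ n, PowerSeries.coeff n (genN β) = N β n := by
    intro n
    rw [genN, PowerSeries.coeff_mk]
    split_ifs with h
    · rw [h, N_zero]
    · rfl
  have hconst : PowerSeries.constantCoeff (genN β) = 1 := by
    rw [← PowerSeries.coeff_zero_eq_constantCoeff_apply, hcoeff, N_zero]
  have hunit : IsUnit (genN β) := by
    rw [PowerSeries.isUnit_iff_constantCoeff, hconst]
    exact isUnit_one
  have hlog : genN β * PowerSeries.derivative _ (PowerSeries.mk (logCoeff β)) =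
      PowerSeries.derivative _ (genN β) := by
    ext1 n
    rw [PowerSeries.coeff_mul, PowerSeries.coeff_derivative, hcoeff]
    have h := mul_N_eq_sum β (n + 1)
    rw [Finset.Nat.antidiagonal_succ', Finset.sum_cons] at h
    simp only [Nat.cast_zero, zero_mul, mul_zero, zero_add, Finset.sum_map] at h
    rw [mul_comm, ← Nat.cast_succ, h]
    refine Finset.sum_congr rfl fun x _ => ?_
    rw [hcoeff, PowerSeries.coeff_derivative, PowerSeries.coeff_mk]
    simp [mul_comm]
  have _ : IsAddTorsionFree ℚ[T;T⁻¹] := .of_module_rat _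
  have : PowerSeries.logOf (genN β) = PowerSeries.mk (logCoeff β) := by
    refine PowerSeries.derivative.ext
      (hunit.mul_left_cancel ((PowerSeries.mul_derivative_logOf hconst).trans hlog.symm)) ?_
    rw [PowerSeries.constantCoeff_logOf hconst, ← PowerSeries.coeff_zero_eq_constantCoeff_apply,
      PowerSeries.coeff_mk, logCoeff_zero]
  rw [Q, this, PowerSeries.coeff_mk]

end LongEdgeGraph

/-! ### Shifts -/

namespace LongEdgeGraph

theorem forall_mem_shift {k : ℕ} {G : LongEdgeGraph} {p : WEdge → Prop} :
    (∀ e ∈ G.shift k, p e.1) ↔ ∀ e ∈ G, p (e.1.shift k) := by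
  simp only [shift, Multiset.mem_map]
  constructor
  · intro h e he
    exact h _ ⟨e, he, rfl⟩
  · rintro h _ ⟨e, he, rfl⟩
    exact h e he

theorem shift_injective (k : ℕ) : Function.Injective (shift k) := by
  refine Multiset.map_injective fun e e' h => ?_
  have h := congrArg Subtype.val h
  simp only [WEdge.shift, WEdge.mk.injEq, add_left_inj] at h
  exact Subtype.ext (WEdge.ext h.1 h.2.1 h.2.2)

theorem exists_shift_eq {k : ℕ} {G : LongEdgeGraph} (h : ∀ e ∈ G, k ≤ e.1.src) :
    ∃ Γ : LongEdgeGraph, Γ.shift k = G := by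
  induction G using Multiset.induction with
  | empty => exact ⟨0, rfl⟩
  | cons e G ih =>
    obtain ⟨Γ, hΓ⟩ := ih fun e' he' => h e' (Multiset.mem_cons_of_mem he')
    have he := h e (Multiset.mem_cons_self e G)
    have hst := e.1.src_lt_tgt
    let e' : WEdge := ⟨e.1.src - k, e.1.tgt - k, e.1.wt, by omega, e.1.wt_pos⟩
    refine ⟨⟨e', fun hs => e.2 ⟨?_, hs.2⟩⟩ ::ₘ Γ, ?_⟩
    · have : e.1.tgt - k = e.1.src - k + 1 := hs.1
      omega
    · rw [shift, Multiset.map_cons]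
      congr 1
      refine Subtype.ext (WEdge.ext ?_ ?_ rfl)
      · exact Nat.sub_add_cancel he
      · exact Nat.sub_add_cancel (he.trans hst.le)

theorem shift_eq_zero {k : ℕ} {G : LongEdgeGraph} : G.shift k = 0 ↔ G = 0 := Multiset.map_eq_zero

theorem mult_shift (k : ℕ) (G : LongEdgeGraph) : (G.shift k).mult = G.mult := by
  rw [mult, shift, Multiset.map_map]
  rfl

theorem cogenus_shift (k : ℕ) (G : LongEdgeGraph) : (G.shift k).cogenus = G.cogenus := by
  rw [cogenus, shift, Multiset.map_map]
  simp [cogenus, WEdge.shift, WEdge.len, Nat.add_sub_add_right]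

/-! ### Extremal vertices -/

theorem minv_le_src {G : LongEdgeGraph} {e : LongEdge} (he : e ∈ G) : G.minv ≤ e.1.src :=
  Nat.sInf_le ⟨e, he, Or.inl rfl⟩

theorem exists_src_eq_minv {G : LongEdgeGraph} (h : G ≠ 0) : ∃ e ∈ G, e.1.src = G.minv := by
  obtain ⟨e₀, he₀⟩ := Multiset.exists_mem_of_ne_zero h
  have hne : {i | ∃ e ∈ G, e.1.Incident i}.Nonempty := ⟨_, e₀, he₀, Or.inl rfl⟩
  obtain ⟨e, he, hi | hi⟩ := Nat.sInf_mem hne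
  · exact ⟨e, he, hi⟩
  · have := minv_le_src he
    have := e.1.src_lt_tgt
    have : e.1.tgt = G.minv := hi
    omega

theorem exists_tgt_eq_maxv {G : LongEdgeGraph} (h : G ≠ 0) : ∃ e ∈ G, e.1.tgt = G.maxv := by
  by_contra! hne
  obtain ⟨e, he⟩ := Multiset.exists_mem_of_ne_zero h
  have h1 : G.maxv ≤ G.maxv - 1 := maxv_le_iff.2 fun e he => by
    have := hne e he
    have := tgt_le_maxv he
    omega
  have := tgt_le_maxv he
  have := e.1.src_lt_tgt
  omega

theorem minv_shift {G : LongEdgeGraph} (h : G ≠ 0) (k : ℕ) : (G.shift k).minv = G.minv + k := by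
  obtain ⟨e, he, hi⟩ := exists_src_eq_minv h
  refine le_antisymm ?_ ?_
  · rw [← hi]
    exact minv_le_src (Multiset.mem_map_of_mem _ he)
  · obtain ⟨e', he', hi'⟩ := exists_src_eq_minv (mt (shift_eq_zero (k := k)).1 h)
    rw [← hi']
    exact forall_mem_shift (p := fun e => G.minv + k ≤ e.src).2
      (fun e he => Nat.add_le_add_right (minv_le_src he) k) e' he'

theorem maxv_shift {G : LongEdgeGraph} (h : G ≠ 0) (k : ℕ) : (G.shift k).maxv = G.maxv + k := by
  obtain ⟨e, he, hi⟩ := exists_tgt_eq_maxv h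
  refine le_antisymm (maxv_le_iff.2 ?_) ?_
  · exact forall_mem_shift (p := fun e => e.tgt ≤ G.maxv + k).2
      fun e he => Nat.add_le_add_right (tgt_le_maxv he) k
  · rw [← hi]
    exact tgt_le_maxv (G := G.shift k) (Multiset.mem_map_of_mem _ he)

/-! ### Templates -/

theorem IsTemplate.length_eq {Γ : LongEdgeGraph} (h : Γ.IsTemplate) : Γ.length = Γ.maxv := by
  rw [length, h.2.1, Nat.sub_zero]

/-- The `ℓ(Γ) - 1` inner vertices of a template are covered by its edges, and an edge `e` covers
`ℓ(e) - 1 ≤ ℓ(e) w(e) - 1` of them. -/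
theorem IsTemplate.maxv_le {Γ : LongEdgeGraph} (h : Γ.IsTemplate) : Γ.maxv ≤ Γ.cogenus + 1 := by
  classical
  have hsub : Finset.Ioo 0 Γ.maxv ⊆ Γ.toFinset.biUnion fun e => Finset.Ioo e.1.src e.1.tgt := by
    intro i hi
    rw [Finset.mem_Ioo] at hi
    obtain ⟨e, he, h1⟩ := h.2.2 i hi.1 (h.length_eq.symm ▸ hi.2)
    exact Finset.mem_biUnion.2 ⟨e, Multiset.mem_toFinset.2 he, Finset.mem_Ioo.2 h1⟩
  have hcard := (Finset.card_le_card hsub).trans Finset.card_biUnion_le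
  have hsum : ∑ e ∈ Γ.toFinset, (Finset.Ioo e.1.src e.1.tgt).card ≤ Γ.cogenus := by
    rw [cogenus, Finset.sum_multiset_map_count]
    refine Finset.sum_le_sum fun e he => ?_
    have hc : 1 ≤ Γ.count e := Multiset.one_le_count_iff_mem.2 (Multiset.mem_toFinset.1 he)
    have hw : e.1.len ≤ e.1.len * e.1.wt := Nat.le_mul_of_pos_right _ e.1.wt_pos
    calc (Finset.Ioo e.1.src e.1.tgt).card = e.1.len - 1 := Nat.card_Ioo _ _
      _ ≤ e.1.len * e.1.wt - 1 := Nat.sub_le_sub_right hw 1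
      _ ≤ Γ.count e • (e.1.len * e.1.wt - 1) := Nat.le_mul_of_pos_left _ hc
  rw [Nat.card_Ioo] at hcard
  omega

theorem finite_templates (δ : ℕ) : {Γ : LongEdgeGraph | Γ.IsTemplate ∧ Γ.cogenus = δ}.Finite :=
  (finite_cogenus_maxv δ (δ + 1)).subset fun _ h => ⟨h.2, h.2 ▸ h.1.maxv_le⟩

/-- A graph on which `Φ_β` does not vanish is a shifted template: otherwise it can be cut at an
inner vertex over which no edge passes. -/
theorem exists_template_of_Phi_ne_zero {M : ℕ} {β : Fin (M + 1) → ℕ} {G : LongEdgeGraph}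
    (h : Phi β G ≠ 0) : ∃ (Γ : LongEdgeGraph) (k : ℕ), Γ.IsTemplate ∧ Γ.shift k = G := by
  classical
  have hG : G ≠ 0 := by
    rintro rfl
    simp [Phi] at h
  obtain ⟨Γ, hΓ⟩ := exists_shift_eq (k := G.minv) (G := G) fun e he => minv_le_src he
  have hΓ0 : Γ ≠ 0 := by rwa [← hΓ, Ne, shift_eq_zero] at hG
  have hmin : Γ.minv = 0 := by
    have := minv_shift hΓ0 G.minv
    rw [hΓ] at this
    omega
  refine ⟨Γ, G.minv, ⟨hΓ0, hmin, fun i hi hi' => ?_⟩, hΓ⟩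
  by_contra! hcut
  rw [length, hmin, Nat.sub_zero] at hi'
  set m := i + G.minv with hm
  have hcut' : ∀ e ∈ G, e.1.src < m → e.1.tgt ≤ m := by
    rw [← hΓ]
    refine (forall_mem_shift (p := fun e => e.src < m → e.tgt ≤ m)).2 fun e he => ?_
    intro hs
    simp only [WEdge.shift, hm, add_lt_add_iff_right, add_le_add_iff_right] at hs ⊢
    exact hcut e he hs
  refine h ?_
  rw [← Multiset.filter_add_not (fun e : LongEdge => e.1.tgt ≤ m) G]
  refine Phi_add_eq_zero β (m := m) (fun e he => (Multiset.mem_filter.1 he).2) (fun e he => ?_)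
    (fun h0 => ?_) fun h0 => ?_
  · obtain ⟨he, he'⟩ := Multiset.mem_filter.1 he
    exact not_lt.1 fun hs => he' (hcut' e he hs)
  · obtain ⟨e, he, hs⟩ := exists_src_eq_minv hG
    exact Multiset.filter_eq_nil.1 h0 e he (hcut' e he (by omega))
  · obtain ⟨e, he, ht⟩ := exists_tgt_eq_maxv hG
    refine Multiset.filter_eq_nil.1 h0 e he ?_
    have := maxv_shift hΓ0 G.minv
    rw [hΓ] at this
    omega

/-- The range of the shifts of a template which are strictly allowable for large `β`. -/
theorem IsTemplate.fitsStrictly_shift_iff {Γ : LongEdgeGraph} (h : Γ.IsTemplate) (M k : ℕ) :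
    (Γ.shift k).FitsStrictly M ↔
      1 - (Γ.eps0 : ℤ) ≤ k ∧ (k : ℤ) ≤ (M : ℤ) - Γ.length + Γ.eps1 := by
  rw [h.length_eq, FitsStrictly, forall_mem_shift
    (p := fun e => e.tgt ≤ M + 1 ∧ (e.Incident 0 ∨ e.Incident (M + 1) → e.wt = 1))]
  simp only [WEdge.Incident, WEdge.shift]
  have hinc₀ : ∀ e ∈ Γ, (e.1.Incident Γ.minv ↔ e.1.src = 0) := fun e he => by
    have := e.1.src_lt_tgt
    rw [h.2.1, WEdge.Incident]
    omega
  have hinc₁ : ∀ e ∈ Γ, (e.1.Incident Γ.maxv ↔ e.1.tgt = Γ.maxv) := fun e he => by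
    have := e.1.src_lt_tgt
    have := tgt_le_maxv he
    rw [WEdge.Incident]
    omega
  constructor
  · intro hf
    obtain ⟨e₁, he₁, ht₁⟩ := exists_tgt_eq_maxv h.1
    have h1 := (hf e₁ he₁).1
    refine ⟨?_, ?_⟩
    · rw [eps0]
      split_ifs with h0
      · simp
      · push Not at h0
        obtain ⟨e, he, hi, hw⟩ := h0
        rw [hinc₀ e he] at hi
        have : k ≠ 0 := fun hk => hw ((hf e he).2 (by omega))
        omega
    · rw [eps1]
      split_ifs with h0
      · push_cast; omega
      · push Not at h0
        obtain ⟨e, he, hi, hw⟩ := h0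
        rw [hinc₁ e he] at hi
        have : Γ.maxv + k ≠ M + 1 := fun hk => hw ((hf e he).2 (by omega))
        push_cast; omega
  · rintro ⟨h0, h1⟩ e he
    have hst := e.1.src_lt_tgt
    have ht := tgt_le_maxv he
    rw [eps0] at h0
    rw [eps1] at h1
    refine ⟨by split_ifs at h1 <;> push_cast at h1 <;> omega, fun hi => ?_⟩
    have hcases : e.1.src + k = 0 ∨ e.1.tgt + k = M + 1 := by
      split_ifs at h1 <;> push_cast at h1 <;> omega
    rcases hcases with hi | hi
    · split_ifs at h0 with hc
      · exact hc e he ((hinc₀ e he).2 (by omega))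
      · push_cast at h0; omega
    · split_ifs at h1 with hc
      · exact hc e he ((hinc₁ e he).2 (by push_cast at h1; omega))
      · push_cast at h1; omega

end LongEdgeGraph

/-! ### The formula for `Q` -/

theorem corollary2 {M : ℕ} (β : Fin (M + 1) → ℕ) (δ : ℕ) :
    {Γ : LongEdgeGraph | Γ.IsTemplate ∧ Γ.cogenus = δ}.Finite ∧
    LongEdgeGraph.Q β δ =
      ∑ᶠ Γ ∈ {Γ : LongEdgeGraph | Γ.IsTemplate ∧ Γ.cogenus = δ},
        Γ.mult * LaurentPolynomial.C
          (∑ k ∈ Finset.Icc (1 - (Γ.eps0 : ℤ)) ((M : ℤ) - Γ.length + Γ.eps1),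
            LongEdgeGraph.Phi β (Γ.shift k.toNat)) := by
  classical
  have hfin := LongEdgeGraph.finite_templates δ
  refine ⟨hfin, ?_⟩
  rw [LongEdgeGraph.Q_eq_logCoeff, LongEdgeGraph.logCoeff, finsum_mem_eq_finite_toFinset_sum _ hfin]
  simp only [map_sum, Finset.mul_sum]
  rw [Finset.sum_sigma']
  have hnonneg : ∀ {Γ : LongEdgeGraph} {k : ℤ}, 1 - (Γ.eps0 : ℤ) ≤ k → 0 ≤ k := by
    intro Γ k hk
    have : Γ.eps0 ≤ 1 := by rw [LongEdgeGraph.eps0]; split_ifs <;> simp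
    omega
  symm
  refine Finset.sum_of_injOn (fun x : (_ : LongEdgeGraph) × ℤ => x.1.shift x.2.toNat) ?_ ?_ ?_ ?_
  · rintro ⟨Γ, k⟩ h ⟨Γ', k'⟩ h' heq
    simp only [Finset.coe_sigma, Set.mem_sigma_iff, Finset.mem_coe, Set.Finite.mem_toFinset,
      Set.mem_ofPred_eq, Finset.mem_Icc] at h h'
    have heq : Γ.shift k.toNat = Γ'.shift k'.toNat := heq
    have hk := hnonneg h.2.1
    have hk' := hnonneg h'.2.1
    -- The shift is recovered as the smallest vertex.
    have hm := congrArg LongEdgeGraph.minv heq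
    rw [LongEdgeGraph.minv_shift h.1.1.1, LongEdgeGraph.minv_shift h'.1.1.1, h.1.1.2.1,
      h'.1.1.2.1] at hm
    obtain rfl : k = k' := by omega
    rw [LongEdgeGraph.shift_injective _ heq]
  · rintro ⟨Γ, k⟩ h
    simp only [Finset.coe_sigma, Set.mem_sigma_iff, Finset.mem_coe, Set.Finite.mem_toFinset,
      Set.mem_ofPred_eq, Finset.mem_Icc] at h
    rw [Finset.mem_coe, LongEdgeGraph.mem_fitting, LongEdgeGraph.cogenus_shift,
      h.1.1.fitsStrictly_shift_iff, Int.toNat_of_nonneg (hnonneg h.2.1)]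
    exact ⟨h.1.2, h.2⟩
  · intro G hG hG'
    rw [LongEdgeGraph.mem_fitting] at hG
    by_cases h0 : LongEdgeGraph.Phi β G = 0
    · rw [h0, map_zero, zero_mul]
    · obtain ⟨Γ, k, hΓ, rfl⟩ := LongEdgeGraph.exists_template_of_Phi_ne_zero h0
      rw [LongEdgeGraph.cogenus_shift, hΓ.fitsStrictly_shift_iff] at hG
      refine absurd ⟨⟨Γ, (k : ℤ)⟩, ?_, by simp⟩ hG'
      simp only [Finset.coe_sigma, Set.mem_sigma_iff, Finset.mem_coe, Set.Finite.mem_toFinset,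
        Set.mem_ofPred_eq, Finset.mem_Icc]
      exact ⟨⟨hΓ, hG.1⟩, hG.2⟩
  · rintro ⟨Γ, k⟩ _
    rw [LongEdgeGraph.mult_shift, mul_comm]
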